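/- Let $d\in\mathbb{N}$ and equip $\mathbb{R}^d$ and $\mathbb{R}^{2d}$ with Lebesgue measure. For $z=(x,\xi)\in\mathbb{R}^{2d}$ let $\rho(z)$ be the symmetric time-frequency shift on $L^2(\mathbb{R}^d)$, $\rho(x,\xi)f(t)=e^{-\pi i x\cdot\xi}e^{2\pi i\xi\cdot t}f(t-x)$. For $1\le p<\infty$ let $\mathcal{S}^p$ be the Schatten class of compact operators on $L^2(\mathbb{R}^d)$ whose singular values satisfy $\|T\|_{\mathcal{S}^p}=(\sum_n s_n(T)^p)^{1/p}<\infty$, and let $\mathcal{S}^\infty$ be the space of all bounded operators with the operator norm. For $T\in\mathcal{S}^1$ let $\mathcal{F}_W(T)(z)=\mathrm{tr}(T\rho(z)^*)$ be its Fourier-Wigner transform, and for $m\in L^\infty(\mathbb{R}^{2d})$ put $$\mathfrak{T}_m(T)=\int_{\mathbb{R}^{2d}}m(z)\,\mathcal{F}_W(T)(z)\,\rho(z)\,dz,\qquad T\in\mathcal{S}^1,$$ as a weak integral. For $1\le p,q\le\infty$ let $\mathfrak{M}_{p,q}$ be the set of all $m\in L^\infty(\mathbb{R}^{2d})$ for which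 $\mathfrak{T}_m$ extends from $\mathcal{S}^1$ to a bounded linear operator $\mathcal{S}^p\to\mathcal{S}^q$, and let $\|m\|_{\mathfrak{M}_{p,q}}$ be the operator norm of this extension (for $p=\infty$, where the extension need not be unique: the infimum of the operator norms of all such extensions). **Proposition.** Let $1\le p,q\le\infty$, with Hölder conjugates $p',q'$ (so $\frac1p+\frac1{p'}=\frac1q+\frac1{q'}=1$). Then $\mathfrak{M}_{p,q}=\mathfrak{M}_{q',p'}$, i.e. $m\in\mathfrak{M}_{p,q}$ if and only if $m\in\mathfrak{M}_{q',p'}$ for every $m\in L^\infty(\mathbb{R}^{2d})$, and $$\|m\|_{\mathfrak{M}_{p,q}}=\|m\|_{\mathfrak{M}_{q',p'}}\qquad\text{for all } m\in\mathfrak{M}_{p,q}.$$ -/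

import Mathlib

open MeasureTheory
open scoped ENNReal NNReal

noncomputable section

namespace QHA

/-- Configuration space `ℝ^d`. -/
abbrev Config (d : ℕ) : Type := EuclideanSpace ℝ (Fin d)

/-- Phase space `ℝ^{2d}`, with points `z = (x, ξ)` and Lebesgue measure. -/
abbrev Phase (d : ℕ) : Type := Config d × Config d

/-- The Hilbert space `L²(ℝ^d)`. -/
abbrev L2 (d : ℕ) : Type := Lp ℂ 2 (volume : Measure (Config d))

/-- The space `L^∞(ℝ^{2d})`. -/
abbrev LInfty (d : ℕ) : Type := Lp ℂ ∞ (volume : Measure (Phase d))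

/-! ### Symmetric time-frequency shifts -/

/-- The function `t ↦ e^{-π i x·ξ} e^{2 π i ξ·t} f(t - x)`, where `z = (x, ξ)`. -/
def shiftFun {d : ℕ} (z : Phase d) (f : Config d → ℂ) (t : Config d) : ℂ :=
  Complex.exp (-(Real.pi * Complex.I * (inner ℝ z.1 z.2 : ℝ))) *
    Complex.exp (2 * Real.pi * Complex.I * (inner ℝ z.2 t : ℝ)) * f (t - z.1)

theorem norm_shiftFun {d : ℕ} (z : Phase d) (f : Config d → ℂ) (t : Config d) :
    ‖shiftFun z f t‖ = ‖f (t - z.1)‖ := by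
  simp [shiftFun, Complex.norm_exp]

theorem memLp_shiftFun {d : ℕ} (z : Phase d) {f : Config d → ℂ} (hf : MemLp f 2 volume) :
    MemLp (shiftFun z f) 2 volume := by
  have h := hf.comp_measurePreserving (measurePreserving_sub_right volume z.1)
  refine MemLp.of_le h ?_ (.of_forall fun t => (norm_shiftFun z f t).le)
  refine AEStronglyMeasurable.mul (Continuous.aestronglyMeasurable ?_) h.1
  fun_prop

theorem shiftFun_congr {d : ℕ} (z : Phase d) {f g : Config d → ℂ} (h : f =ᵐ[volume] g) :
    shiftFun z f =ᵐ[volume] shiftFun z g := by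
  have h' := (measurePreserving_sub_right volume z.1).quasiMeasurePreserving.ae h
  filter_upwards [h'] with t ht
  simp only [shiftFun, ht]

/-- The symmetric time-frequency shift `ρ(z)` on `L²(ℝ^d)`,
`ρ(x, ξ) f (t) = e^{-π i x·ξ} e^{2 π i ξ·t} f(t - x)`, as an isometry. -/
def rhoIsometry {d : ℕ} (z : Phase d) : L2 d →ₗᵢ[ℂ] L2 d where
  toFun f := (memLp_shiftFun z (Lp.memLp f)).toLp _
  map_add' f g := by
    rw [← MemLp.toLp_add]
    refine MemLp.toLp_congr _ _ ((shiftFun_congr z (Lp.coeFn_add f g)).trans ?_)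
    exact .of_forall fun t => by simp [shiftFun, mul_add]
  map_smul' c f := by
    rw [RingHom.id_apply, ← MemLp.toLp_const_smul]
    refine MemLp.toLp_congr _ _ ((shiftFun_congr z (Lp.coeFn_smul c f)).trans ?_)
    exact .of_forall fun t => by simp [shiftFun]; ring
  norm_map' f := by
    change ‖(memLp_shiftFun z (Lp.memLp f)).toLp _‖ = ‖f‖
    rw [Lp.norm_toLp, Lp.norm_def]
    congr 1
    rw [eLpNorm_congr_norm_ae (.of_forall fun t => norm_shiftFun z f t)]
    exact eLpNorm_comp_measurePreserving (Lp.aestronglyMeasurable f)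
      (measurePreserving_sub_right volume z.1)

/-- The symmetric time-frequency shift `ρ(z)` as a bounded operator on `L²(ℝ^d)`. -/
def rho {d : ℕ} (z : Phase d) : L2 d →L[ℂ] L2 d := (rhoIsometry z).toContinuousLinearMap

theorem coeFn_rho {d : ℕ} (z : Phase d) (f : L2 d) :
    (rho z f : Config d → ℂ) =ᵐ[volume] shiftFun z f :=
  MemLp.coeFn_toLp (memLp_shiftFun z (Lp.memLp f))

/-! ### Schatten classes -/

section Schatten

variable {H : Type} [NormedAddCommGroup H] [InnerProductSpace ℂ H]

/-- A singular value decomposition `T = ∑ᵢ sᵢ eᵢ ⊗ ηᵢ`, where `(e ⊗ η) f = ⟨f, η⟩ e`, with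
orthonormal families `e`, `η` and singular values `sᵢ ≥ 0`. The series converges
(unconditionally) in operator norm, so an operator with such a decomposition is compact. The
index type is arbitrary, which allows finite families; some of the `sᵢ` may vanish. -/
def IsSVD {ι : Type} (T : H →L[ℂ] H) (s : ι → ℝ≥0) (e η : ι → H) : Prop :=
  Orthonormal ℂ e ∧ Orthonormal ℂ η ∧
    HasSum (fun i => ((s i : ℝ) : ℂ) • InnerProductSpace.rankOne ℂ (e i) (η i)) T

/-- The Schatten norm `‖T‖_{S^p}` with values in `[0, ∞]`. For `p = ∞` it is the operator norm.
For `p < ∞` it is `(∑ᵢ sᵢ(T)^p)^{1/p}`, computed from a singular value decomposition; the value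
is the same for all decompositions of `T`, and it is `∞` if there is none, i.e. if `T` is not
compact. -/
def schattenNorm (p : ℝ≥0∞) (T : H →L[ℂ] H) : ℝ≥0∞ :=
  if p = ∞ then ‖T‖ₑ
  else sInf {c : ℝ≥0∞ | ∃ (ι : Type) (s : ι → ℝ≥0) (e η : ι → H), IsSVD T s e η ∧
    c = (∑' i, (s i : ℝ≥0∞) ^ p.toReal) ^ (1 / p.toReal)}

/-- The Schatten class `S^p`; in particular `S^∞` consists of all bounded operators. -/
def schattenClass (H : Type) [NormedAddCommGroup H] [InnerProductSpace ℂ H] (p : ℝ≥0∞) :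
    Set (H →L[ℂ] H) :=
  {T | schattenNorm p T < ∞}

/-- The trace `∑ᵢ ⟨T bᵢ, bᵢ⟩` of a trace class operator, computed in some orthonormal basis `b`
of the Hilbert space. -/
def trace [CompleteSpace H] (T : H →L[ℂ] H) : ℂ :=
  ∑' i, inner ℂ ((exists_hilbertBasis ℂ H).choose_spec.choose i)
    (T ((exists_hilbertBasis ℂ H).choose_spec.choose i))

/-- `A` is the weak integral `∫ F(z) dμ(z)` of an operator-valued function: for all `f, g`, the
function `z ↦ ⟨F(z) f, g⟩` is integrable with integral `⟨A f, g⟩`. -/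
def IsWeakIntegral {Z : Type} [MeasurableSpace Z] (μ : Measure Z) (F : Z → H →L[ℂ] H)
    (A : H →L[ℂ] H) : Prop :=
  ∀ f g : H, Integrable (fun z => inner ℂ g (F z f)) μ ∧
    ∫ z, inner ℂ g (F z f) ∂μ = inner ℂ g (A f)

end Schatten

/-! ### Fourier-Wigner multipliers -/

/-- The Fourier-Wigner transform `F_W(T)(z) = tr(T ρ(z)^*)` of a trace class operator. -/
def fourierWigner {d : ℕ} (T : L2 d →L[ℂ] L2 d) (z : Phase d) : ℂ :=
  trace (T ∘L ContinuousLinearMap.adjoint (rho z))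

/-- `A = 𝔗_m(T)`, i.e. `A` is the weak integral `∫ m(z) F_W(T)(z) ρ(z) dz`. -/
def IsMultiplierImage {d : ℕ} (m : LInfty d) (T A : L2 d →L[ℂ] L2 d) : Prop :=
  IsWeakIntegral volume (fun z => (m z * fourierWigner T z) • rho z) A

/-- `Φ` restricts to a linear operator from `S^p` to `S^q` with `‖Φ T‖_{S^q} ≤ C ‖T‖_{S^p}` for
all `T ∈ S^p`, and it extends `𝔗_m`, which is defined on the trace class `S^1`. (The values of
`Φ` outside `S^p` are irrelevant.) -/
structure IsBoundedExtension {d : ℕ} (m : LInfty d) (p q : ℝ≥0∞) (C : ℝ≥0)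
    (Φ : (L2 d →L[ℂ] L2 d) → (L2 d →L[ℂ] L2 d)) : Prop where
  map_add : ∀ S ∈ schattenClass (L2 d) p, ∀ T ∈ schattenClass (L2 d) p, Φ (S + T) = Φ S + Φ T
  map_smul : ∀ (c : ℂ), ∀ T ∈ schattenClass (L2 d) p, Φ (c • T) = c • Φ T
  bound : ∀ T ∈ schattenClass (L2 d) p, schattenNorm q (Φ T) ≤ C * schattenNorm p T
  extends_multiplier : ∀ T ∈ schattenClass (L2 d) 1, IsMultiplierImage m T (Φ T)

/-- The set `𝔐_{p,q}` of all `m ∈ L^∞(ℝ^{2d})` for which `𝔗_m` extends to a bounded linear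
operator from `S^p` to `S^q`. -/
def multipliers (d : ℕ) (p q : ℝ≥0∞) : Set (LInfty d) :=
  {m | ∃ (C : ℝ≥0) (Φ : (L2 d →L[ℂ] L2 d) → (L2 d →L[ℂ] L2 d)), IsBoundedExtension m p q C Φ}

/-- The multiplier norm `‖m‖_{𝔐_{p,q}}`, i.e. the operator norm of the extension of `𝔗_m` to a
bounded linear operator from `S^p` to `S^q` (and `∞` if there is none). The extension is unique
for `p < ∞`, since `S^1` is then dense in `S^p`; for `p = ∞` the norm is the infimum of the
operator norms of the extensions. -/
def multiplierNorm {d : ℕ} (p q : ℝ≥0∞) (m : LInfty d) : ℝ≥0∞ :=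
  sInf {c : ℝ≥0∞ | ∃ (C : ℝ≥0) (Φ : (L2 d →L[ℂ] L2 d) → (L2 d →L[ℂ] L2 d)),
    IsBoundedExtension m p q C Φ ∧ c = C}

end QHA

end

/-! The transpose of `𝔗_m` under the trace pairing `(T, S) ↦ tr(TS)` is again `𝔗_m`, up to
conjugation by the parity operator `P`. Since `ρ(z)^* = PρP`, the number `tr((PTP)ρ(z))` is
`F_W(T)(z)`, while `F_W(Pf ⊗ Pg)(z) = ⟨ρ(z)f, g⟩`. Hence `tr((PTP) 𝔗_m(Pf ⊗ Pg))` and `⟨𝔗_m(T)f, g⟩`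
are both the integral of `m(z) F_W(T)(z) ⟨ρ(z)f, g⟩`.

Given an extension `Φ` with constant `C` and `T ∈ S^{q'}`, Hölder's inequality `trace_comp_holder`
bounds the functional `S ↦ tr(TΦ(S))` on `S^p` by `C‖T‖`. By `exists_representing_operator` it is
given on rank one operators by an operator of `S^{p'}`-norm at most `C‖T‖`; conjugating with `P`
yields the extension for `(q', p')` with the same `C` (`IsBoundedExtension.exists_dual`). Applying
this twice gives both inclusions and both norm inequalities.

The functional is only tested on finite rank operators, so `p = ∞` requires no density or
uniqueness. The Schatten norm is an infimum over decompositions: upper bounds exhibit one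
decomposition (`exists_isSVD_of_sum_rpow_le`), lower bounds treat all of them
(`le_mul_schattenNorm`), and independence of the decomposition is never needed. -/

noncomputable section

namespace QHA

open Filter Topology Module End InnerProductSpace

/-! ### Compactness and singular value decompositions from bounds on diagonal entries. -/

section SVD

variable {H : Type} [NormedAddCommGroup H] [InnerProductSpace ℂ H]

/-- A compact self-adjoint operator has a Hilbert basis of eigenvectors. -/
theorem exists_hilbertBasis_eigenvectors [CompleteSpace H] {K : H →L[ℂ] H}
    (hK : IsCompactOperator K) (hK' : K.IsSymmetric) :
    ∃ (ι : Type) (b : HilbertBasis ι ℂ H) (μ : ι → ℂ), ∀ i, K (b i) = μ i • b i := by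
  have hcl : ∀ μ : ℂ, CompleteSpace (eigenspace (K : End ℂ H) μ) := fun μ => by
    have : IsClosed ((eigenspace (K : End ℂ H) μ : Submodule ℂ H) : Set H) := by
      have h : ((eigenspace (K : End ℂ H) μ : Submodule ℂ H) : Set H) = {x | K x = μ • x} := by
        ext x; simp
      rw [h]
      exact isClosed_eq K.continuous (continuous_const_smul μ)
    exact this.completeSpace_coe
  choose w b hb using fun μ : ℂ => exists_hilbertBasis ℂ (eigenspace (K : End ℂ H) μ)
  have hv : Orthonormal ℂ (fun a : Σ μ, w μ => ((b a.1 a.2 : eigenspace (K : End ℂ H) a.1) : H)) :=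
    hK'.orthogonalFamily_eigenspaces.orthonormal_sigma_orthonormal fun μ => (b μ).orthonormal
  -- All complex `μ` are allowed as indices: a non-eigenvalue has trivial eigenspace, hence an empty
  -- basis.
  refine ⟨Σ μ, w μ, HilbertBasis.mkOfOrthogonalEqBot hv ?_, fun a => a.1, fun a => ?_⟩
  · rw [Submodule.eq_bot_iff]
    intro x hx
    have hx' : x ∈ (⨆ μ, eigenspace (K : End ℂ H) μ)ᗮ := by
      rw [← Submodule.iInf_orthogonal, Submodule.mem_iInf]
      intro μ y hy
      have h1 := (b μ).hasSum_repr ⟨y, hy⟩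
      have h2 := h1.mapL (eigenspace (K : End ℂ H) μ).subtypeL
      have h3 := h2.mapL (innerSL ℂ x)
      have h4 : (fun i => innerSL ℂ x ((eigenspace (K : End ℂ H) μ).subtypeL
          ((b μ).repr ⟨y, hy⟩ i • b μ i))) = fun _ => 0 := by
        ext i
        have := (Submodule.mem_orthogonal' _ x).1 hx _ (Submodule.subset_span ⟨⟨μ, i⟩, rfl⟩)
        simp [this]
      rw [h4] at h3
      have := h3.unique hasSum_zero
      exact inner_eq_zero_symm.1 (by simpa using this)
    rwa [ContinuousLinearMap.orthogonalComplement_iSup_eigenspaces_eq_bot hK hK'] at hx'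
  · rw [HilbertBasis.coe_mkOfOrthogonalEqBot]
    exact mem_eigenspace_iff.1 (b a.1 a.2).2

theorem isCompactOperator_of_finiteDimensional_comp {V : Submodule ℂ H} [FiniteDimensional ℂ V]
    (S : V →L[ℂ] H) (R : H →L[ℂ] V) : IsCompactOperator (S ∘L R) :=
  have : ProperSpace V := FiniteDimensional.proper ℂ V
  (isCompactOperator_of_locallyCompactSpace_rng S).comp_clm R

/-- An operator whose diagonal entries with respect to arbitrary orthonormal families are
`r`-summable, uniformly, is compact. -/
theorem isCompactOperator_of_sum_rpow_le [CompleteSpace H] {X : H →L[ℂ] H} {r : ℝ} (hr : 0 < r)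
    {M : ℝ} (h : ∀ (ι : Type) [Fintype ι] (f g : ι → H), Orthonormal ℂ f → Orthonormal ℂ g →
      ∑ k, ‖inner ℂ (g k) (X (f k))‖ ^ r ≤ M) : IsCompactOperator X := by
  by_contra hX
  have hopen : {f : H →L[ℂ] H | IsCompactOperator f}ᶜ ∈ 𝓝 X :=
    (isClosed_setOfPred_isCompactOperator (σ₁₂ := RingHom.id ℂ)).isOpen_compl.mem_nhds hX
  obtain ⟨δ, hδ, hball⟩ := Metric.mem_nhds_iff.1 hopen
  have hdist : ∀ F : H →L[ℂ] H, IsCompactOperator F → δ ≤ ‖X - F‖ := fun F hF => by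
    by_contra! hlt
    exact hball (by rwa [Metric.mem_ball, dist_comm, dist_eq_norm]) hF
  -- If `X` is at distance `δ` from the compact operators, orthonormal `f_n`, `g_n` with `|⟨g_n, X
  -- f_n⟩| ≥ δ/2` can be chosen inductively. Compressing `X` to the complements of the earlier
  -- vectors changes it by a finite rank operator, so the compression `Y` still has norm at least
  -- `δ`.
  obtain ⟨u, hu, hu'⟩ := exists_seq_of_forall_finset_exists
    (P := fun y : H × H => ‖y.1‖ = 1 ∧ ‖y.2‖ = 1 ∧ δ / 2 ≤ ‖inner ℂ y.2 (X y.1)‖)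
    (r := fun x y => inner ℂ x.1 y.1 = 0 ∧ inner ℂ x.2 y.2 = 0) fun s _ => by
      classical
      set V := Submodule.span ℂ ((s.image Prod.fst : Finset H) : Set H) with hV
      set W := Submodule.span ℂ ((s.image Prod.snd : Finset H) : Set H) with hW
      have : FiniteDimensional ℂ V := FiniteDimensional.span_finset ℂ _
      have : FiniteDimensional ℂ W := FiniteDimensional.span_finset ℂ _
      set Y : H →L[ℂ] H := Wᗮ.starProjection ∘L X ∘L Vᗮ.starProjection with hY
      have hYc : IsCompactOperator (X - Y) := by
        have : X - Y = (X ∘L V.subtypeL) ∘L V.orthogonalProjectionOnto +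
            (W.subtypeL ∘L W.orthogonalProjectionOnto ∘L X ∘L Vᗮ.starProjection) := by
          ext x
          simp [hY, Submodule.starProjection_orthogonal']
          abel
        rw [this]
        exact (isCompactOperator_of_finiteDimensional_comp _ _).add
          (isCompactOperator_of_finiteDimensional_comp W.subtypeL _)
      have hYn : δ / 2 < ‖Y‖ := by
        have := hdist _ hYc
        rw [sub_sub_cancel] at this
        linarith
      obtain ⟨x, hx⟩ : ∃ x, δ / 2 * ‖x‖ < ‖Y x‖ := by
        by_contra! hcon
        exact hYn.not_ge (Y.opNorm_le_bound (by positivity) hcon)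
      set y := Vᗮ.starProjection x with hy
      set v := Wᗮ.starProjection (X y) with hv
      have hyx : ‖y‖ ≤ ‖x‖ := Submodule.norm_starProjection_apply_le _ _
      have hvn : δ / 2 * ‖x‖ < ‖v‖ := hx
      have hv0 : 0 < ‖v‖ := lt_of_le_of_lt (by positivity) hvn
      have hy0 : 0 < ‖y‖ := by
        rw [norm_pos_iff]
        intro h0
        rw [hv, h0] at hv0
        simp at hv0
      have hyV : y ∈ Vᗮ := Submodule.starProjection_apply_mem _ _
      have hvW : v ∈ Wᗮ := Submodule.starProjection_apply_mem _ _
      have hin : inner ℂ v (X y) = (‖v‖ : ℂ) ^ 2 := by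
        refine Eq.trans ?_ (inner_self_eq_norm_sq_to_K (𝕜 := ℂ) v)
        nth_rewrite 3 [hv]
        rw [← Submodule.inner_starProjection_left_eq_right,
          Submodule.starProjection_eq_self_iff.2 hvW]
      refine ⟨(((‖y‖ : ℂ)⁻¹) • y, ((‖v‖ : ℂ)⁻¹) • v), ⟨?_, ?_, ?_⟩, fun z hz => ⟨?_, ?_⟩⟩
      · simp [norm_smul, hy0.ne']
      · simp [norm_smul, hv0.ne']
      · simp only [map_smul, inner_smul_left, inner_smul_right, hin]
        simp only [norm_mul, norm_pow, map_inv₀, norm_inv, Complex.conj_ofReal,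
          Complex.norm_real, norm_norm]
        rw [show ‖y‖⁻¹ * (‖v‖⁻¹ * ‖v‖ ^ 2) = ‖v‖ / ‖y‖ by field_simp, le_div_iff₀ hy0]
        nlinarith
      · rw [inner_smul_right, (Submodule.mem_orthogonal _ _).1 hyV _ (Submodule.subset_span
          (by simpa using ⟨_, hz⟩)), mul_zero]
      · rw [inner_smul_right, (Submodule.mem_orthogonal _ _).1 hvW _ (Submodule.subset_span
          (by simpa using ⟨_, hz⟩)), mul_zero]
  have ho : ∀ {w : ℕ → H}, (∀ n, ‖w n‖ = 1) → (∀ m n, m < n → inner ℂ (w m) (w n) = 0) →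
      Orthonormal ℂ w := fun {w} h1 h2 => ⟨h1, fun m n hmn => by
    rcases lt_or_gt_of_ne hmn with hlt | hlt
    · exact h2 _ _ hlt
    · exact inner_eq_zero_symm.1 (h2 _ _ hlt)⟩
  have hf : Orthonormal ℂ fun n => (u n).1 := ho (fun n => (hu n).1) fun m n h => (hu' m n h).1
  have hg : Orthonormal ℂ fun n => (u n).2 := ho (fun n => (hu n).2.1) fun m n h => (hu' m n h).2
  obtain ⟨N, hN⟩ := exists_nat_gt (M / (δ / 2) ^ r)
  have hsum := h (Fin N) _ _ (hf.comp _ Fin.val_injective) (hg.comp _ Fin.val_injective)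
  have hlow : ∑ _k : Fin N, (δ / 2) ^ r ≤ M := le_trans (Finset.sum_le_sum fun k _ =>
    Real.rpow_le_rpow (by positivity) (hu k).2.2 hr.le) hsum
  rw [div_lt_iff₀ (by positivity)] at hN
  simp at hlow
  linarith

/-- An operator whose diagonal entries with respect to arbitrary orthonormal families are
`r`-summable, uniformly, has a singular value decomposition with `r`-summable singular values. -/
theorem exists_isSVD_of_sum_rpow_le [CompleteSpace H] {X : H →L[ℂ] H} {r : ℝ} (hr : 0 < r)
    {M : ℝ≥0} (h : ∀ (ι : Type) [Fintype ι] (f g : ι → H), Orthonormal ℂ f → Orthonormal ℂ g →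
      ∑ k, ‖inner ℂ (g k) (X (f k))‖ ^ r ≤ M) :
    ∃ (ι : Type) (s : ι → ℝ≥0) (e η : ι → H), IsSVD X s e η ∧
      ∑' i, (s i : ℝ≥0∞) ^ r ≤ M := by
  have hX := isCompactOperator_of_sum_rpow_le hr h
  set K : H →L[ℂ] H := ContinuousLinearMap.adjoint X ∘L X with hK
  have hKc : IsCompactOperator K := hX.clm_comp (ContinuousLinearMap.adjoint X)
  have hKs : K.IsSymmetric := fun x y => by
    simp [hK, ContinuousLinearMap.adjoint_inner_left, ContinuousLinearMap.adjoint_inner_right]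
  obtain ⟨κ, b, μ, hb⟩ := exists_hilbertBasis_eigenvectors hKc hKs
  have hXX : ∀ x y, inner ℂ (X x) (X y) = inner ℂ (K x) y := fun x y => by
    simp [hK, ContinuousLinearMap.adjoint_inner_left]
  have horth : ∀ i j, i ≠ j → inner ℂ (X (b i)) (X (b j)) = 0 := fun i j hij => by
    rw [hXX, hb, inner_smul_left, b.orthonormal.2 hij, mul_zero]
  -- The eigenvalue `μ i` of `X^*X` is `‖X (b i)‖ ^ 2`, so the singular values are the norms `‖X (b
  -- i)‖` and no square root of an operator is needed.
  have hself : ∀ i y, inner ℂ (X (b i)) (X y) = (‖X (b i)‖ : ℂ) ^ 2 * inner ℂ (b i) y :=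
      fun i y => by
    have h1 : inner ℂ (X (b i)) (X (b i)) = (starRingEnd ℂ) (μ i) := by
      rw [hXX, hb, inner_smul_left, inner_self_eq_norm_sq_to_K, b.orthonormal.1 i]
      simp
    have h2 := inner_self_eq_norm_sq_to_K (𝕜 := ℂ) (X (b i))
    rw [hXX, hb, inner_smul_left, ← h1, h2]
    rfl
  let ι := {i : κ // X (b i) ≠ 0}
  have hpos : ∀ i : ι, 0 < ‖X (b i)‖ := fun i => norm_pos_iff.2 i.2
  let s : ι → ℝ≥0 := fun i => ‖X (b i)‖₊
  let η : ι → H := fun i => b i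
  let e : ι → H := fun i => ((‖X (b i)‖ : ℂ)⁻¹) • X (b i)
  have hη : Orthonormal ℂ η := b.orthonormal.comp _ Subtype.val_injective
  have he : Orthonormal ℂ e := by
    refine ⟨fun i => ?_, fun i j hij => ?_⟩
    · simp [e, norm_smul, (hpos i).ne']
    · simp [e, inner_smul_left, inner_smul_right,
        horth i j (fun h => hij (Subtype.ext h))]
  have hse : ∀ i, ((s i : ℝ) : ℂ) • rankOne ℂ (e i) (η i) = rankOne ℂ (X (b i)) (η i) := by
    intro i
    have : (‖X (b i)‖ : ℂ) ≠ 0 := by exact_mod_cast (hpos i).ne'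
    simp [s, e, smul_smul, this]
  have hentry : ∀ i, inner ℂ (e i) (X (η i)) = (‖X (b i)‖ : ℂ) := by
    intro i
    have h2 := inner_self_eq_norm_sq_to_K (𝕜 := ℂ) (X (b i))
    have : (‖X (b i)‖ : ℂ) ≠ 0 := by exact_mod_cast (hpos i).ne'
    simp only [e, η, inner_smul_left, h2]
    simp
    field_simp
  have hfin : ∀ F : Finset ι, ∑ i ∈ F, (s i : ℝ) ^ r ≤ M := fun F => by
    have := h F (fun i => η i) (fun i => e i) (hη.comp _ Subtype.val_injective)
      (he.comp _ Subtype.val_injective)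
    simp only [hentry] at this
    rw [← Finset.sum_coe_sort]
    simpa [s] using this
  have hfin' : ∑' i, (s i : ℝ≥0∞) ^ r ≤ M := by
    refine ENNReal.summable.tsum_le_of_sum_le fun F => ?_
    have := hfin F
    have h3 : ∑ i ∈ F, s i ^ r ≤ M := by exact_mod_cast this
    calc ∑ i ∈ F, (s i : ℝ≥0∞) ^ r = ((∑ i ∈ F, s i ^ r : ℝ≥0) : ℝ≥0∞) := by
          push_cast
          exact Finset.sum_congr rfl fun i _ => (ENNReal.coe_rpow_of_nonneg _ hr.le).symm
      _ ≤ M := by exact_mod_cast h3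
  refine ⟨ι, s, e, η, ⟨he, hη, ?_⟩, hfin'⟩
  simp only [hse]
  have hsum : Summable fun i => (s i : ℝ) ^ r :=
    summable_of_sum_le (fun i => by positivity) hfin
  rw [HasSum, Metric.tendsto_nhds]
  intro ε hε
  have hev := hsum.tendsto_cofinite_zero.eventually_lt_const
    (show (0 : ℝ) < (ε / 2) ^ r by positivity)
  have hF0 : {i | ¬ (s i : ℝ) ^ r < (ε / 2) ^ r}.Finite := hev
  filter_upwards [eventually_ge_atTop hF0.toFinset] with F hF
  have hsmall : ∀ i : ι, i ∉ F → ‖X (b i)‖ ≤ ε / 2 := fun i hi => by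
    by_contra! hlt
    exact hi (hF (by simpa [s] using Real.rpow_le_rpow (by positivity) hlt.le hr.le))
  rw [dist_comm, dist_eq_norm]
  -- Operator norm convergence: outside `F` all singular values are at most `ε / 2`, and the
  -- remainder `X y` is estimated by Parseval in the eigenbasis.
  refine lt_of_le_of_lt (ContinuousLinearMap.opNorm_le_bound _ (half_pos hε).le fun x => ?_)
    (half_lt_self hε)
  set y := x - ∑ i ∈ F, inner ℂ (η i) x • η i with hy
  have hXy : (X - ∑ i ∈ F, rankOne ℂ (X (b i)) (η i)) x = X y := by
    simp [hy, η]
  rw [hXy]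
  have hby : ∀ i : ι, i ∈ F → inner ℂ (η i) y = 0 := fun i hi => by
    rw [hy, inner_sub_right, hη.inner_right_sum _ hi, sub_self]
  have hbx : ∀ i, ‖inner ℂ (b i) y‖ ≤ ‖inner ℂ (b i) x‖ := fun i => by
    by_cases hi : ∃ j ∈ F, η j = b i
    · obtain ⟨j, hj, hji⟩ := hi
      rw [← hji, hby j hj]
      simp
    · rw [hy, inner_sub_right, inner_sum, Finset.sum_eq_zero, sub_zero]
      intro j hj
      rw [inner_smul_right, b.orthonormal.2, mul_zero]
      rintro rfl
      exact hi ⟨j, hj, rfl⟩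
  have hterm : ∀ i, inner ℂ y (b i) * inner ℂ (b i) (K y) =
      ((‖X (b i)‖ ^ 2 * ‖inner ℂ (b i) y‖ ^ 2 : ℝ) : ℂ) := fun i => by
    have : inner ℂ (b i) (K y) = inner ℂ (X (b i)) (X y) := by
      rw [hXX]; exact (hKs _ _).symm
    rw [this, hself, ← inner_conj_symm y]
    push_cast
    rw [← Complex.conj_mul']
    ring
  have h1 : HasSum (fun i => ‖X (b i)‖ ^ 2 * ‖inner ℂ (b i) y‖ ^ 2) (‖X y‖ ^ 2) := by
    have := b.hasSum_inner_mul_inner y (K y)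
    simp only [hterm] at this
    rw [show inner ℂ y (K y) = ((‖X y‖ ^ 2 : ℝ) : ℂ) by
      rw [show inner ℂ y (K y) = inner ℂ (K y) y from (hKs y y).symm, ← hXX]
      simp] at this
    exact_mod_cast this
  have h2 : HasSum (fun i => ‖inner ℂ (b i) x‖ ^ 2) (‖x‖ ^ 2) := by
    have := b.hasSum_inner_mul_inner x x
    rw [inner_self_eq_norm_sq_to_K] at this
    simp only [← inner_conj_symm x (b _), Complex.conj_mul'] at this
    exact Complex.hasSum_ofReal.1 (by simpa using this)
  have h3 : ‖X y‖ ^ 2 ≤ (ε / 2) ^ 2 * ‖x‖ ^ 2 := by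
    refine hasSum_le (fun i => ?_) h1 (h2.mul_left _)
    have hb2 : ‖inner ℂ (b i) y‖ ^ 2 ≤ ‖inner ℂ (b i) x‖ ^ 2 := by
      gcongr; exact hbx i
    by_cases hi : X (b i) = 0
    · rw [hi]
      simp
      positivity
    by_cases hiF : (⟨i, hi⟩ : ι) ∈ F
    · have : inner ℂ (b i) y = 0 := hby ⟨i, hi⟩ hiF
      rw [this]
      simp
      positivity
    · have := hsmall ⟨i, hi⟩ hiF
      gcongr
  rw [← mul_pow] at h3
  exact (sq_le_sq₀ (norm_nonneg _) (by positivity)).1 h3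

end SVD

/-! ### Traces and Hölder's inequality for Schatten classes. -/

section Holder

/-- Hölder's inequality for a doubly substochastic kernel. -/
theorem tsum_tsum_mul_le_of_substochastic {ι κ : Type} {s : ι → ℝ≥0∞} {t : κ → ℝ≥0∞}
    {a : ι → κ → ℝ≥0∞} (ha : ∀ i, ∑' j, a i j ≤ 1) (ha' : ∀ j, ∑' i, a i j ≤ 1) {p q : ℝ}
    (hpq : p.HolderConjugate q) :
    ∑' i, ∑' j, s i * (t j * a i j) ≤
      (∑' i, s i ^ p) ^ (1 / p) * (∑' j, t j ^ q) ^ (1 / q) := by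
  let _ : MeasurableSpace (ι × κ) := ⊤
  have hp := hpq.pos
  have hq := hpq.symm.pos
  -- Splitting `a = a^{1/p} a^{1/q}` reduces the claim to Hölder for the counting measure; the row
  -- and column sums then remove `a`.
  have h := ENNReal.lintegral_mul_le_Lp_mul_Lq (Measure.count : Measure (ι × κ)) hpq
    (f := fun x => s x.1 * a x.1 x.2 ^ (1 / p)) (g := fun x => t x.2 * a x.1 x.2 ^ (1 / q))
    (Measurable.of_discrete.aemeasurable) (Measurable.of_discrete.aemeasurable)
  simp only [lintegral_count, Pi.mul_apply] at h
  have hpow : ∀ (x : ℝ≥0∞) {r : ℝ}, 0 < r → (x ^ (1 / r)) ^ r = x := fun x r hr => by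
    rw [← ENNReal.rpow_mul, one_div_mul_cancel hr.ne', ENNReal.rpow_one]
  have h1 : ∑' x : ι × κ, (s x.1 * a x.1 x.2 ^ (1 / p)) ^ p ≤ ∑' i, s i ^ p := by
    rw [ENNReal.tsum_prod']
    refine ENNReal.tsum_le_tsum fun i => ?_
    simp only [ENNReal.mul_rpow_of_nonneg _ _ hp.le, hpow _ hp, ENNReal.tsum_mul_left]
    exact mul_le_of_le_one_right' (ha i)
  have h2 : ∑' x : ι × κ, (t x.2 * a x.1 x.2 ^ (1 / q)) ^ q ≤ ∑' j, t j ^ q := by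
    rw [ENNReal.tsum_prod', ENNReal.tsum_comm]
    refine ENNReal.tsum_le_tsum fun j => ?_
    simp only [ENNReal.mul_rpow_of_nonneg _ _ hq.le, hpow _ hq, ENNReal.tsum_mul_left]
    exact mul_le_of_le_one_right' (ha' j)
  have h3 : ∑' i, ∑' j, s i * (t j * a i j) =
      ∑' x : ι × κ, s x.1 * a x.1 x.2 ^ (1 / p) * (t x.2 * a x.1 x.2 ^ (1 / q)) := by
    rw [ENNReal.tsum_prod']
    refine tsum_congr fun i => tsum_congr fun j => ?_
    have : a i j = a i j ^ (1 / p) * a i j ^ (1 / q) := by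
      rw [← ENNReal.rpow_add_of_nonneg _ _ (by positivity) (by positivity), one_div, one_div,
        hpq.inv_add_inv_eq_one, ENNReal.rpow_one]
    nth_rewrite 1 [this]
    ring
  rw [h3]
  exact h.trans (by gcongr)

variable {H : Type} [NormedAddCommGroup H] [InnerProductSpace ℂ H]

theorem enorm_inner_symm (x y : H) : ‖inner ℂ x y‖ₑ = ‖inner ℂ y x‖ₑ := by
  rw [← ofReal_norm, norm_inner_symm, ofReal_norm]

/-- Cauchy–Schwarz followed by Bessel. This makes the kernels in Hölder's inequality substochastic.
-/
theorem tsum_enorm_inner_mul_inner_le {κ : Type} {u v : κ → H} (hu : Orthonormal ℂ u)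
    (hv : Orthonormal ℂ v) (x y : H) :
    ∑' j, ‖inner ℂ x (u j)‖ₑ * ‖inner ℂ (v j) y‖ₑ ≤ ‖x‖ₑ * ‖y‖ₑ := by
  refine ENNReal.summable.tsum_le_of_sum_le fun F => ?_
  simp only [← ofReal_norm, ← ENNReal.ofReal_mul (norm_nonneg _)]
  rw [← ENNReal.ofReal_sum_of_nonneg fun i _ => by positivity]
  refine ENNReal.ofReal_le_ofReal ((Real.sum_mul_le_sqrt_mul_sqrt F _ _).trans ?_)
  have h1 := hu.sum_inner_products_le x (s := F)
  have h2 := hv.sum_inner_products_le y (s := F)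
  simp only [norm_inner_symm x]
  exact mul_le_mul (Real.sqrt_le_iff.2 ⟨norm_nonneg _, h1⟩) (Real.sqrt_le_iff.2 ⟨norm_nonneg _, h2⟩)
    (Real.sqrt_nonneg _) (norm_nonneg _)

/-- Pythagoras for `e` and Bessel for `η`. -/
theorem norm_sum_smul_rankOne_le {ι : Type} {e η : ι → H} (he : Orthonormal ℂ e)
    (hη : Orthonormal ℂ η) {c : ι → ℂ} {M : ℝ} (hM : 0 ≤ M) (F : Finset ι)
    (hc : ∀ i ∈ F, ‖c i‖ ≤ M) :
    ‖∑ i ∈ F, c i • rankOne ℂ (e i) (η i)‖ ≤ M := by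
  refine ContinuousLinearMap.opNorm_le_bound _ hM fun x => ?_
  have h1 : (∑ i ∈ F, c i • rankOne ℂ (e i) (η i)) x = ∑ i ∈ F, (c i * inner ℂ (η i) x) • e i := by
    simp [smul_smul]
  have h2 : ‖∑ i ∈ F, (c i * inner ℂ (η i) x) • e i‖ ^ 2 =
      ∑ i ∈ F, ‖c i * inner ℂ (η i) x‖ ^ 2 := by
    have := he.inner_sum (fun i => c i * inner ℂ (η i) x) (fun i => c i * inner ℂ (η i) x) F
    rw [inner_self_eq_norm_sq_to_K] at this
    simp only [Complex.conj_mul'] at this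
    exact Complex.ofReal_injective (by simpa using this)
  rw [h1]
  refine (sq_le_sq₀ (norm_nonneg _) (by positivity)).1 ?_
  rw [h2, mul_pow]
  calc ∑ i ∈ F, ‖c i * inner ℂ (η i) x‖ ^ 2 ≤ ∑ i ∈ F, M ^ 2 * ‖inner ℂ (η i) x‖ ^ 2 := by
        refine Finset.sum_le_sum fun i hi => ?_
        rw [norm_mul, mul_pow]
        gcongr
        exact hc i hi
    _ ≤ M ^ 2 * ‖x‖ ^ 2 := by
        rw [← Finset.mul_sum]
        gcongr
        exact hη.sum_inner_products_le x

theorem IsSVD.hasSum_inner {ι : Type} {T : H →L[ℂ] H} {s : ι → ℝ≥0} {e η : ι → H}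
    (h : IsSVD T s e η) (x y : H) :
    HasSum (fun i => ((s i : ℝ) : ℂ) * (inner ℂ x (e i) * inner ℂ (η i) y)) (inner ℂ x (T y)) := by
  have := (h.2.2.mapL (ContinuousLinearMap.apply ℂ H y)).mapL (innerSL ℂ x)
  refine (this.congr_fun ?_)
  intro i
  simpa using Or.inl (mul_comm _ _)

theorem enorm_le_tsum_of_hasSum {ι : Type} {f : ι → ℂ} {a : ℂ} (h : HasSum f a) :
    ‖a‖ₑ ≤ ∑' i, ‖f i‖ₑ := h.tsum_eq ▸ enorm_tsum_le_tsum_enorm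

/-- The sum of the matrix entries of a nuclear operator along an arbitrary Hilbert basis. -/
theorem hasSum_diagonal_of_nuclear {ι κ : Type} (b : HilbertBasis κ ℂ H) {t : ι → ℝ≥0}
    {x y : ι → H} {R : ℝ≥0∞} (hR : R ≠ ∞) (hxy : ∀ i, ‖y i‖ₑ * ‖x i‖ₑ ≤ R)
    (ht : ∑' i, (t i : ℝ≥0∞) ≠ ∞) {T : H →L[ℂ] H}
    (hT : ∀ k, HasSum (fun i => ((t i : ℝ) : ℂ) * (inner ℂ (b k) (x i) * inner ℂ (y i) (b k)))
      (inner ℂ (b k) (T (b k)))) :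
    HasSum (fun k => inner ℂ (b k) (T (b k))) (∑' i, ((t i : ℝ) : ℂ) * inner ℂ (y i) (x i)) ∧
      ∑' k, ‖inner ℂ (b k) (T (b k))‖ₑ ≤ (∑' i, (t i : ℝ≥0∞)) * R := by
  -- The double series `G` converges absolutely. Summing over `i` first gives the diagonal of `T`;
  -- summing over `k` first gives, by Parseval, a series that does not involve `b`.
  set G : κ × ι → ℂ :=
    fun z => ((t z.2 : ℝ) : ℂ) * (inner ℂ (b z.1) (x z.2) * inner ℂ (y z.2) (b z.1)) with hG
  have hGn : ∑' k, ∑' i, ‖G (k, i)‖ₑ ≤ (∑' i, (t i : ℝ≥0∞)) * R := by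
    rw [ENNReal.tsum_comm, ← ENNReal.tsum_mul_right]
    refine ENNReal.tsum_le_tsum fun i => ?_
    have h1 : ∀ k, ‖G (k, i)‖ₑ =
        (t i : ℝ≥0∞) * (‖inner ℂ (y i) (b k)‖ₑ * ‖inner ℂ (b k) (x i)‖ₑ) := fun k => by
      simp only [hG, enorm_mul]
      rw [mul_comm ‖inner ℂ (b k) (x i)‖ₑ]
      congr 1
      simp [enorm_eq_nnnorm]
    simp only [h1, ENNReal.tsum_mul_left]
    gcongr
    exact (tsum_enorm_inner_mul_inner_le b.orthonormal b.orthonormal _ _).trans (hxy i)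
  have hGs : Summable G := by
    rw [← summable_norm_iff, ← tsum_enorm_ne_top_iff_summable_norm, ENNReal.tsum_prod']
    exact ne_top_of_le_ne_top (ENNReal.mul_ne_top ht hR) hGn
  have h1 : HasSum (fun k => inner ℂ (b k) (T (b k))) (∑' z, G z) :=
    hGs.hasSum.prod_fiberwise hT
  have h2 : HasSum (fun i => ((t i : ℝ) : ℂ) * inner ℂ (y i) (x i)) (∑' z, G z) := by
    have := (Equiv.prodComm ι κ).hasSum_iff.2 hGs.hasSum
    refine this.prod_fiberwise fun i => ?_
    have h3 := (b.hasSum_inner_mul_inner (y i) (x i)).mul_left ((t i : ℝ) : ℂ)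
    refine h3.congr_fun fun k => ?_
    simp [hG, mul_comm]
  refine ⟨h2.tsum_eq ▸ h1, le_trans (ENNReal.tsum_le_tsum fun k => ?_) hGn⟩
  exact enorm_le_tsum_of_hasSum (hT k)

variable (H) in
/-- The Hilbert basis used in the definition of `trace`. -/
def traceBasis [CompleteSpace H] : HilbertBasis (exists_hilbertBasis ℂ H).choose ℂ H :=
  (exists_hilbertBasis ℂ H).choose_spec.choose

/-- The diagonal of `T` in the basis used to define `trace` is summable. -/
def HasSummableDiagonal [CompleteSpace H] (T : H →L[ℂ] H) : Prop :=
  Summable fun k => inner ℂ (traceBasis H k) (T (traceBasis H k))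

theorem trace_eq [CompleteSpace H] (T : H →L[ℂ] H) :
    trace T = ∑' k, inner ℂ (traceBasis H k) (T (traceBasis H k)) := rfl

theorem trace_add [CompleteSpace H] {S T : H →L[ℂ] H} (hS : HasSummableDiagonal S)
    (hT : HasSummableDiagonal T) : trace (S + T) = trace S + trace T := by
  simp only [trace_eq, add_apply, inner_add_right]
  exact Summable.tsum_add hS hT

theorem trace_smul [CompleteSpace H] (c : ℂ) (T : H →L[ℂ] H) : trace (c • T) = c * trace T := by
  simp only [trace_eq, smul_apply, inner_smul_right]
  exact tsum_mul_left

theorem hasSummableDiagonal_of_tsum_enorm [CompleteSpace H] {T : H →L[ℂ] H} {R : ℝ≥0∞}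
    (hR : R ≠ ∞) (h : ∑' k, ‖inner ℂ (traceBasis H k) (T (traceBasis H k))‖ₑ ≤ R) :
    HasSummableDiagonal T ∧ ‖trace T‖ₑ ≤ R :=
  ⟨summable_norm_iff.1 (tsum_enorm_ne_top_iff_summable_norm.1 (ne_top_of_le_ne_top hR h)),
    enorm_tsum_le_tsum_enorm.trans h⟩

theorem enorm_comp_le_of_norm_one (B : H →L[ℂ] H) {x y : H} (hx : ‖x‖ = 1) (hy : ‖y‖ = 1) :
    ‖B x‖ₑ * ‖y‖ₑ ≤ ‖B‖ₑ ∧ ‖y‖ₑ * ‖B x‖ₑ ≤ ‖B‖ₑ := by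
  have h1 : ‖B x‖ₑ ≤ ‖B‖ₑ := by
    rw [← ofReal_norm, ← ofReal_norm]
    exact ENNReal.ofReal_le_ofReal (by simpa [hx] using B.le_opNorm x)
  have h2 : ‖y‖ₑ = 1 := by simpa [← ofReal_norm] using hy
  simp [h2, h1]

/-- Here `AB = ∑ sᵢ eᵢ ⊗ B^*ηᵢ` is nuclear. The resulting basis-free series is what later trace
identities are checked on, in place of cyclicity. -/
theorem IsSVD.trace_comp_left [CompleteSpace H] {ι : Type} {A : H →L[ℂ] H} {s : ι → ℝ≥0}
    {e η : ι → H} (hA : IsSVD A s e η) (hs : ∑' i, (s i : ℝ≥0∞) ≠ ∞) (B : H →L[ℂ] H) :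
    trace (A ∘L B) = ∑' i, ((s i : ℝ) : ℂ) * inner ℂ (η i) (B (e i)) ∧
      ∑' k, ‖inner ℂ (traceBasis H k) ((A ∘L B) (traceBasis H k))‖ₑ ≤
        (∑' i, (s i : ℝ≥0∞)) * ‖B‖ₑ := by
  have := hasSum_diagonal_of_nuclear (traceBasis H) (t := s) (x := e)
    (y := fun i => ContinuousLinearMap.adjoint B (η i)) (R := ‖B‖ₑ) (T := A ∘L B) (by simp)
    (fun i => by
      have := (enorm_comp_le_of_norm_one (ContinuousLinearMap.adjoint B) (hA.2.1.1 i)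
        (hA.1.1 i)).1
      simpa [← ofReal_norm] using this) hs (fun k => by
      simpa [ContinuousLinearMap.adjoint_inner_left] using
        hA.hasSum_inner (traceBasis H k) (B (traceBasis H k)))
  refine ⟨?_, this.2⟩
  simpa [ContinuousLinearMap.adjoint_inner_left, trace_eq] using this.1.tsum_eq

theorem IsSVD.tsum_diagonal_comp_right [CompleteSpace H] {ι : Type} {B : H →L[ℂ] H} {s : ι → ℝ≥0}
    {e η : ι → H} (hB : IsSVD B s e η) (hs : ∑' i, (s i : ℝ≥0∞) ≠ ∞) (A : H →L[ℂ] H) :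
      ∑' k, ‖inner ℂ (traceBasis H k) ((A ∘L B) (traceBasis H k))‖ₑ ≤
        (∑' i, (s i : ℝ≥0∞)) * ‖A‖ₑ := by
  refine (hasSum_diagonal_of_nuclear (traceBasis H) (t := s) (x := fun i => A (e i))
    (y := η) (R := ‖A‖ₑ) (T := A ∘L B) (by simp)
    (fun i => (enorm_comp_le_of_norm_one A (hB.1.1 i) (hB.2.1.1 i)).2) hs (fun k => ?_)).2
  simpa [ContinuousLinearMap.adjoint_inner_left] using
    hB.hasSum_inner (ContinuousLinearMap.adjoint A (traceBasis H k)) (traceBasis H k)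

theorem exists_norm_eq_one_mul_eq (z : ℂ) : ∃ θ : ℂ, ‖θ‖ = 1 ∧ θ * z = ‖z‖ := by
  by_cases hz : z = 0
  · exact ⟨1, by simp, by simp [hz]⟩
  · have hz' : (‖z‖ : ℂ) ≠ 0 := by simpa using hz
    refine ⟨(starRingEnd ℂ) z / ‖z‖, by simp [hz], ?_⟩
    rw [div_mul_eq_mul_div, Complex.conj_mul']
    field_simp

/-- Hölder's inequality for the diagonal of a product, in terms of singular values. -/
theorem IsSVD.tsum_diagonal_comp_le [CompleteSpace H] {ι κ ν : Type} (b : HilbertBasis ν ℂ H)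
    {A B : H →L[ℂ] H} {s : ι → ℝ≥0} {e η : ι → H} (hA : IsSVD A s e η) {t : κ → ℝ≥0} {f g : κ → H}
    (hB : IsSVD B t f g) {p q : ℝ} (hpq : p.HolderConjugate q) :
    ∑' k, ‖inner ℂ (b k) ((A ∘L B) (b k))‖ₑ ≤
      (∑' i, (s i : ℝ≥0∞) ^ p) ^ (1 / p) * (∑' j, (t j : ℝ≥0∞) ^ q) ^ (1 / q) := by
  refine ENNReal.summable.tsum_le_of_sum_le fun F => ?_
  choose θ hθ hθ' using fun k => exists_norm_eq_one_mul_eq (inner ℂ (b k) ((A ∘L B) (b k)))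
  -- The contraction `D` carries the phases, so the finite sum of absolute values equals `∑ sᵢ ⟨B D
  -- eᵢ, ηᵢ⟩`. Expanding `B` as well leaves a kernel that is substochastic because `‖D‖ ≤ 1`.
  set D : H →L[ℂ] H := ∑ k ∈ F, θ k • rankOne ℂ (b k) (b k) with hD
  have hDn : ‖D‖ ≤ 1 := norm_sum_smul_rankOne_le b.orthonormal b.orthonormal zero_le_one F
    fun k _ => (hθ k).le
  have hDn' : ‖D‖ₑ ≤ 1 := by
    rw [← ofReal_norm]
    exact ENNReal.ofReal_le_one.2 hDn
  have hsum : HasSum (fun i => ((s i : ℝ) : ℂ) * inner ℂ (η i) (B (D (e i))))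
      (∑ k ∈ F, θ k * inner ℂ (b k) ((A ∘L B) (b k))) := by
    have := hasSum_sum (s := F) fun k _ => (hA.hasSum_inner (b k) (B (b k))).mul_left (θ k)
    refine this.congr_fun fun i => ?_
    simp only [hD, sum_apply, smul_apply, rankOne_apply, map_sum, map_smul,
      inner_sum, inner_smul_right, Finset.mul_sum]
    exact Finset.sum_congr rfl fun k _ => by ring
  have hle := enorm_le_tsum_of_hasSum hsum
  simp only [hθ', ← Complex.ofReal_sum] at hle
  have h0 : ‖((∑ k ∈ F, ‖inner ℂ (b k) ((A ∘L B) (b k))‖ : ℝ) : ℂ)‖ₑ =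
      ∑ k ∈ F, ‖inner ℂ (b k) ((A ∘L B) (b k))‖ₑ := by
    rw [← ofReal_norm, Complex.norm_real, Real.norm_of_nonneg (by positivity),
      ENNReal.ofReal_sum_of_nonneg fun _ _ => norm_nonneg _]
    simp only [ofReal_norm]
  rw [h0] at hle
  refine hle.trans ?_
  refine le_trans ?_ (tsum_tsum_mul_le_of_substochastic (s := fun i => (s i : ℝ≥0∞))
    (t := fun j => (t j : ℝ≥0∞))
    (a := fun i j => ‖inner ℂ (η i) (f j)‖ₑ * ‖inner ℂ (g j) (D (e i))‖ₑ) ?_ ?_ hpq)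
  · refine ENNReal.tsum_le_tsum fun i => ?_
    rw [ENNReal.tsum_mul_left, enorm_mul]
    have h1 : ‖((s i : ℝ) : ℂ)‖ₑ = s i := by simp [← ofReal_norm]
    rw [h1]
    gcongr
    refine (enorm_le_tsum_of_hasSum (hB.hasSum_inner (η i) (D (e i)))).trans
      (ENNReal.tsum_le_tsum fun j => ?_)
    simp [← ofReal_norm]
  · intro i
    refine (tsum_enorm_inner_mul_inner_le hB.1 hB.2.1 _ _).trans ?_
    exact (enorm_comp_le_of_norm_one D (hA.1.1 i) (hA.2.1.1 i)).2.trans hDn'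
  · intro j
    have := tsum_enorm_inner_mul_inner_le hA.2.1 hA.1 (f j) (ContinuousLinearMap.adjoint D (g j))
    refine le_trans (le_of_eq ?_) (this.trans ((enorm_comp_le_of_norm_one
      (ContinuousLinearMap.adjoint D) (hB.2.1.1 j) (hB.1.1 j)).2.trans ?_))
    · refine tsum_congr fun i => ?_
      rw [ContinuousLinearMap.adjoint_inner_right, enorm_inner_symm (f j),
        enorm_inner_symm (D (e i))]
    · rw [← ofReal_norm, LinearIsometryEquiv.norm_map, ofReal_norm]
      exact hDn'

/-- To bound a quantity by a multiple of the Schatten norm, it suffices to bound it in terms of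
all singular value decompositions. -/
theorem le_mul_schattenNorm {p : ℝ≥0∞} (hp : p ≠ ∞) {T : H →L[ℂ] H} (hT : T ∈ schattenClass H p)
    {a R : ℝ≥0∞} (ha : a ≠ ∞)
    (h : ∀ (ι : Type) (s : ι → ℝ≥0) (e η : ι → H), IsSVD T s e η →
      (∑' i, (s i : ℝ≥0∞) ^ p.toReal) ^ (1 / p.toReal) ≠ ∞ →
      R ≤ a * (∑' i, (s i : ℝ≥0∞) ^ p.toReal) ^ (1 / p.toReal)) :
    R ≤ a * schattenNorm p T := by
  have hT' : schattenNorm p T < ∞ := hT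
  simp only [schattenNorm, if_neg hp] at hT' ⊢
  set S := {c : ℝ≥0∞ | ∃ (ι : Type) (s : ι → ℝ≥0) (e η : ι → H), IsSVD T s e η ∧
    c = (∑' i, (s i : ℝ≥0∞) ^ p.toReal) ^ (1 / p.toReal)} with hS
  by_contra! hcon
  have hne : S.Nonempty := by
    rw [Set.nonempty_iff_ne_empty]
    intro h0
    simp [h0] at hT'
  -- The infimum need not be known to be attained: multiplication by the finite `a` is continuous,
  -- so some finite `c ∈ S` would also violate the bound.
  have hopen : {c : ℝ≥0∞ | a * c < R} ∩ Set.Iio ∞ ∈ 𝓝 (sInf S) :=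
    (((isOpen_lt (ENNReal.continuous_const_mul ha) continuous_const)).inter isOpen_Iio).mem_nhds
      ⟨hcon, hT'⟩
  obtain ⟨c, ⟨hc1, hc2⟩, ι, s, e, η, hsvd, rfl⟩ :=
    mem_closure_iff_nhds.1 (sInf_mem_closure hne) _ hopen
  exact (h ι s e η hsvd (ne_of_lt hc2)).not_gt hc1

/-- **Hölder's inequality** for Schatten classes. -/
theorem trace_comp_holder [CompleteSpace H] {p q : ℝ≥0∞} (hpq : ENNReal.HolderConjugate p q)
    {A B : H →L[ℂ] H} (hA : A ∈ schattenClass H p) (hB : B ∈ schattenClass H q) :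
    HasSummableDiagonal (A ∘L B) ∧ ‖trace (A ∘L B)‖ₑ ≤ schattenNorm p A * schattenNorm q B := by
  have hA' : schattenNorm p A ≠ ∞ := ne_of_lt hA
  have hB' : schattenNorm q B ≠ ∞ := ne_of_lt hB
  refine hasSummableDiagonal_of_tsum_enorm (ENNReal.mul_ne_top hA' hB') ?_
  -- At the endpoints one factor is merely bounded and only the trace class factor is decomposed.
  by_cases hp : p = ∞
  · have hq : q = 1 := by
      subst hp; exact (ENNReal.HolderConjugate.unique ∞ 1 q).symm
    subst hp hq
    refine le_mul_schattenNorm ENNReal.one_ne_top hB hA' fun ι s e η hs hfin => ?_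
    have := hs.tsum_diagonal_comp_right (by simpa using hfin) A
    simpa [schattenNorm, mul_comm] using this
  by_cases hq : q = ∞
  · have hp : p = 1 := by
      subst hq; exact (ENNReal.HolderConjugate.unique ∞ 1 p).symm
    subst hp hq
    rw [mul_comm]
    refine le_mul_schattenNorm ENNReal.one_ne_top hA hB' fun ι s e η hs hfin => ?_
    have := (hs.trace_comp_left (by simpa using hfin) B).2
    simpa [schattenNorm, mul_comm] using this
  have hr := ENNReal.HolderConjugate.toReal_of_ne_top hp hq
  refine le_mul_schattenNorm hq hB hA' fun κ t f g ht hfin => ?_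
  rw [mul_comm]
  refine le_mul_schattenNorm hp hA hfin fun ι s e η hs _ => ?_
  rw [mul_comm]
  exact hs.tsum_diagonal_comp_le _ ht hr

end Holder

/-! ### Representing functionals on Schatten classes by operators. -/

section Duality

variable {H : Type} [NormedAddCommGroup H] [InnerProductSpace ℂ H]

theorem isSVD_sum {ι : Type} {e η : ι → H} (he : Orthonormal ℂ e) (hη : Orthonormal ℂ η)
    (c : ι → ℝ≥0) (F : Finset ι) :
    IsSVD (∑ i ∈ F, ((c i : ℝ) : ℂ) • rankOne ℂ (e i) (η i)) (fun i : F => c i)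
      (fun i : F => e i) (fun i : F => η i) := by
  refine ⟨he.comp _ Subtype.val_injective, hη.comp _ Subtype.val_injective, ?_⟩
  rw [← Finset.sum_coe_sort F fun i => ((c i : ℝ) : ℂ) • rankOne ℂ (e i) (η i)]
  exact hasSum_fintype _

theorem schattenNorm_sum_le {p : ℝ≥0∞} (hp : p ≠ ∞) {ι : Type} {e η : ι → H}
    (he : Orthonormal ℂ e) (hη : Orthonormal ℂ η) (c : ι → ℝ≥0) (F : Finset ι) :
    schattenNorm p (∑ i ∈ F, ((c i : ℝ) : ℂ) • rankOne ℂ (e i) (η i)) ≤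
      (∑ i ∈ F, (c i : ℝ≥0∞) ^ p.toReal) ^ (1 / p.toReal) := by
  rw [schattenNorm, if_neg hp]
  refine sInf_le ⟨F, _, _, _, isSVD_sum he hη c F, ?_⟩
  rw [tsum_fintype, Finset.sum_coe_sort F fun i => (c i : ℝ≥0∞) ^ p.toReal]

theorem schattenNorm_top_sum_le {ι : Type} {e η : ι → H} (he : Orthonormal ℂ e)
    (hη : Orthonormal ℂ η) {c : ι → ℝ≥0} {M : ℝ≥0} (F : Finset ι) (hc : ∀ i ∈ F, c i ≤ M) :
    schattenNorm ∞ (∑ i ∈ F, ((c i : ℝ) : ℂ) • rankOne ℂ (e i) (η i)) ≤ M := by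
  rw [schattenNorm, if_pos rfl, ← ofReal_norm, ← ENNReal.ofReal_coe_nnreal]
  exact ENNReal.ofReal_le_ofReal
    (norm_sum_smul_rankOne_le he hη M.2 F fun i hi => by simpa using hc i hi)

theorem sum_mem_schattenClass {p : ℝ≥0∞} {ι : Type} {e η : ι → H}
    (he : Orthonormal ℂ e) (hη : Orthonormal ℂ η) (c : ι → ℝ≥0) (F : Finset ι) :
    ∑ i ∈ F, ((c i : ℝ) : ℂ) • rankOne ℂ (e i) (η i) ∈ schattenClass H p := by
  by_cases hp : p = ∞
  · subst hp
    exact (schattenNorm_top_sum_le he hη F fun i hi => Finset.le_sup hi).trans_lt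
      ENNReal.coe_lt_top
  · refine (schattenNorm_sum_le hp he hη c F).trans_lt ?_
    refine ENNReal.rpow_lt_top_of_nonneg (by positivity) (ENNReal.sum_ne_top.2 fun i _ => ?_)
    exact ENNReal.rpow_ne_top_of_nonneg (by positivity) ENNReal.coe_ne_top

theorem schattenNorm_rankOne_le {p : ℝ≥0∞} (hp : 1 ≤ p) (f g : H) :
    schattenNorm p (rankOne ℂ f g) ≤ ‖f‖ₑ * ‖g‖ₑ := by
  by_cases htop : p = ∞
  · simp [schattenNorm, htop]
  have hp0 : 0 < p.toReal := ENNReal.toReal_pos (by positivity) htop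
  by_cases h0 : f = 0 ∨ g = 0
  · have h1 : rankOne ℂ f g = 0 := by rcases h0 with rfl | rfl <;> simp
    -- The zero operator is decomposed over the empty family, as no unit vector need exist.
    have h2 := schattenNorm_sum_le (H := H) htop (e := fun i : Empty => i.elim)
      (η := fun i : Empty => i.elim) (Orthonormal.of_isEmpty _) (Orthonormal.of_isEmpty _)
      (fun _ => 0) ∅
    rw [h1]
    refine (by simpa using h2 : _ ≤ (0 : ℝ≥0∞) ^ p.toReal⁻¹).trans ?_
    simp [ENNReal.zero_rpow_of_pos (inv_pos.2 hp0)]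
  push Not at h0
  have hf : (‖f‖ : ℂ) ≠ 0 := by simpa using h0.1
  have hg : (‖g‖ : ℂ) ≠ 0 := by simpa using h0.2
  have ho : ∀ {x : H}, x ≠ 0 → Orthonormal ℂ fun _ : Unit => ((‖x‖ : ℂ)⁻¹) • x := fun {x} hx =>
    ⟨fun _ => by simp [norm_smul, hx], fun i j hij => (hij rfl).elim⟩
  have h2 := schattenNorm_sum_le htop (ho h0.1) (ho h0.2) (fun _ => ‖f‖₊ * ‖g‖₊) {()}
  have h3 : (((‖f‖₊ * ‖g‖₊ : ℝ≥0) : ℝ) : ℂ) • rankOne ℂ (((‖f‖ : ℂ)⁻¹) • f) (((‖g‖ : ℂ)⁻¹) • g) =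
      rankOne ℂ f g := by
    ext x
    simp only [map_smul, map_smulₛₗ, smul_apply, smul_smul, NNReal.coe_mul,
      coe_nnnorm, Complex.ofReal_mul, map_inv₀, Complex.conj_ofReal]
    rw [show (‖f‖ : ℂ) * ‖g‖ * ((‖g‖ : ℂ)⁻¹ * (‖f‖ : ℂ)⁻¹) = 1 by field_simp, one_smul]
  simp only [Finset.sum_singleton, h3] at h2
  refine h2.trans (le_of_eq ?_)
  rw [← ENNReal.rpow_mul, mul_one_div_cancel hp0.ne', ENNReal.rpow_one]
  simp [enorm_eq_nnnorm]

theorem rankOne_mem_schattenClass {p : ℝ≥0∞} (hp : 1 ≤ p) (f g : H) :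
    rankOne ℂ f g ∈ schattenClass H p :=
  (schattenNorm_rankOne_le hp f g).trans_lt (ENNReal.mul_lt_top enorm_lt_top enorm_lt_top)

/-- A bounded linear functional on the Schatten class of exponent `p` is represented, on operators
of finite rank, by an operator in the Schatten class of the conjugate exponent. -/
theorem exists_representing_operator [CompleteSpace H] {p p' : ℝ≥0∞}
    (hp : ENNReal.HolderConjugate p p') {L : (H →L[ℂ] H) → ℂ} {K : ℝ≥0}
    (hadd : ∀ S ∈ schattenClass H p, ∀ T ∈ schattenClass H p, L (S + T) = L S + L T)
    (hsmul : ∀ (c : ℂ), ∀ T ∈ schattenClass H p, L (c • T) = c * L T)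
    (hbound : ∀ T ∈ schattenClass H p, ‖L T‖ₑ ≤ K * schattenNorm p T) :
    ∃ X : H →L[ℂ] H, (∀ f g, inner ℂ g (X f) = L (rankOne ℂ f g)) ∧ schattenNorm p' X ≤ K := by
  have hp1 : 1 ≤ p := ENNReal.HolderConjugate.one_le p p'
  have hr : ∀ f g : H, rankOne ℂ f g ∈ schattenClass H p := rankOne_mem_schattenClass hp1
  have hLr : ∀ f g : H, ‖L (rankOne ℂ f g)‖ ≤ K * ‖g‖ * ‖f‖ := fun f g => by
    have h1 : ‖L (rankOne ℂ f g)‖ₑ ≤ K * (‖f‖ₑ * ‖g‖ₑ) := (hbound _ (hr f g)).trans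
      (by gcongr; exact schattenNorm_rankOne_le hp1 f g)
    simp only [enorm_eq_nnnorm] at h1
    have h2 : ‖L (rankOne ℂ f g)‖₊ ≤ K * (‖f‖₊ * ‖g‖₊) := by exact_mod_cast h1
    have h3 : ‖L (rankOne ℂ f g)‖ ≤ K * (‖f‖ * ‖g‖) := by exact_mod_cast h2
    linarith
  -- `rankOne ℂ f g` is conjugate linear in `g`, so `L` restricts to a bounded sesquilinear form,
  -- which an operator represents.
  let B : H →L⋆[ℂ] H →L[ℂ] ℂ := LinearMap.mkContinuous₂
    (LinearMap.mk₂'ₛₗ (starRingEnd ℂ) (RingHom.id ℂ) (fun g f => L (rankOne ℂ f g))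
      (fun g g' f => by rw [map_add, hadd _ (hr _ _) _ (hr _ _)])
      (fun c g f => by rw [map_smulₛₗ, hsmul _ _ (hr _ _), smul_eq_mul])
      (fun g f f' => by rw [map_add, add_apply, hadd _ (hr _ _) _ (hr _ _)])
      (fun c g f => by
        rw [map_smul, smul_apply, hsmul _ _ (hr _ _), smul_eq_mul, RingHom.id_apply]))
    K (fun g f => hLr f g)
  set X : H →L[ℂ] H := ContinuousLinearMap.adjoint (continuousLinearMapOfBilin B) with hX
  have hXL : ∀ f g, inner ℂ g (X f) = L (rankOne ℂ f g) := fun f g => by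
    rw [hX, ContinuousLinearMap.adjoint_inner_right, continuousLinearMapOfBilin_apply]
    rfl
  refine ⟨X, hXL, ?_⟩
  by_cases hp' : p' = ∞
  · have : ‖X‖ ≤ K := X.opNorm_le_bound K.2 fun f => by
      have h1 := hLr f (X f)
      rw [← hXL, inner_self_eq_norm_sq_to_K] at h1
      have h2 : ‖X f‖ ^ 2 ≤ K * ‖X f‖ * ‖f‖ := by simpa using h1
      rcases (norm_nonneg (X f)).eq_or_lt with h0 | h0
      · rw [← h0]; positivity
      · refine le_of_mul_le_mul_left ?_ h0
        linarith
    rw [schattenNorm, if_pos hp', ← ofReal_norm, ← ENNReal.ofReal_coe_nnreal]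
    exact ENNReal.ofReal_le_ofReal this
  have hp'1 : 1 ≤ p' := ENNReal.HolderConjugate.one_le p' p
  have hp'0 : 0 < p'.toReal := ENNReal.toReal_pos (by positivity) hp'
  have hL0 : L 0 = 0 := by simpa using hsmul 0 _ (hr 0 0)
  -- Absorbing phases into `f'` makes `L` of the test operator equal to a pairing of `c` with the
  -- absolute values of the diagonal entries.
  have hpair : ∀ (ι : Type) [Fintype ι] (f g : ι → H), Orthonormal ℂ f → Orthonormal ℂ g →
      ∃ f' : ι → H, Orthonormal ℂ f' ∧ ∀ c : ι → ℝ≥0,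
        ((∑ k, ‖inner ℂ (g k) (X (f k))‖₊ * c k : ℝ≥0) : ℝ≥0∞) ≤
          K * schattenNorm p (∑ k, ((c k : ℝ) : ℂ) • rankOne ℂ (f' k) (g k)) := by
    intro ι _ f g hf hg
    choose θ hθ hθ' using fun k => exists_norm_eq_one_mul_eq (inner ℂ (g k) (X (f k)))
    have hf' : Orthonormal ℂ fun k => θ k • f k := ⟨fun k => by
      simp [norm_smul, hθ, hf.1 k], fun i j hij => by
      simp [inner_smul_left, inner_smul_right, hf.2 hij]⟩
    refine ⟨_, hf', fun c => ?_⟩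
    have hsum : ∀ F : Finset ι, L (∑ k ∈ F, ((c k : ℝ) : ℂ) • rankOne ℂ (θ k • f k) (g k)) =
        ((∑ k ∈ F, ‖inner ℂ (g k) (X (f k))‖₊ * c k : ℝ≥0) : ℝ) := by
      classical
      intro F
      induction F using Finset.induction_on with
      | empty => simp [hL0]
      | insert a F ha ih =>
        have h1 := sum_mem_schattenClass (p := p) hf' hg c {a}
        rw [Finset.sum_singleton] at h1
        rw [Finset.sum_insert ha, Finset.sum_insert ha,
          hadd _ h1 _ (sum_mem_schattenClass hf' hg c F), ih, hsmul _ _ (hr _ _), ← hXL, map_smul,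
          inner_smul_right, hθ']
        push_cast
        ring
    have := hbound _ (sum_mem_schattenClass (p := p) hf' hg c Finset.univ)
    rw [hsum] at this
    refine le_trans (le_of_eq ?_) this
    rw [← ofReal_norm, Complex.norm_real, Real.norm_of_nonneg (NNReal.coe_nonneg _),
      ENNReal.ofReal_coe_nnreal]
  have hmain : ∀ (ι : Type) [Fintype ι] (f g : ι → H), Orthonormal ℂ f → Orthonormal ℂ g →
      ∑ k, ‖inner ℂ (g k) (X (f k))‖ ^ p'.toReal ≤ (K ^ p'.toReal : ℝ≥0) := by
    intro ι _ f g hf hg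
    obtain ⟨f', hf', hc⟩ := hpair ι f g hf hg
    suffices h : ∑ k, ‖inner ℂ (g k) (X (f k))‖₊ ^ p'.toReal ≤ K ^ p'.toReal by
      simpa using NNReal.coe_le_coe.2 h
    by_cases htop : p = ∞
    · have h1 : p' = 1 := by subst htop; exact (ENNReal.HolderConjugate.unique ∞ 1 p').symm
      have h2 := (hc fun _ => 1).trans (mul_le_mul_right (schattenNorm_top_sum_le hf' hg
        (c := fun _ => 1) (M := 1) Finset.univ (fun _ _ => le_rfl) |> fun h => htop ▸ h) _)
      simp only [ENNReal.coe_one, mul_one] at h2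
      simpa [h1] using ENNReal.coe_le_coe.1 h2
    · have hconj := ENNReal.HolderConjugate.toReal_of_ne_top htop hp'
      -- The weights `c` are the extremal case of Hölder: they lie in the unit ball of `ℓ^p` and
      -- attain the `ℓ^{p'}` norm of the diagonal.
      obtain ⟨⟨c, hc1, hc2⟩, -⟩ := NNReal.isGreatest_Lp Finset.univ
        (fun k => ‖inner ℂ (g k) (X (f k))‖₊) hconj.symm
      have h1 := (hc c).trans (mul_le_mul_right (schattenNorm_sum_le htop hf' hg c Finset.univ) _)
      have h2 : (∑ k, (c k : ℝ≥0∞) ^ p.toReal) ^ (1 / p.toReal) ≤ 1 := by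
        refine ENNReal.rpow_le_one ?_ (by positivity)
        have h3 : ((∑ k, c k ^ p.toReal : ℝ≥0) : ℝ≥0∞) ≤ 1 := by exact_mod_cast hc1
        refine le_trans (le_of_eq ?_) h3
        push_cast
        exact Finset.sum_congr rfl fun i _ =>
          (ENNReal.coe_rpow_of_nonneg _ hconj.nonneg).symm
      have h4 := ENNReal.coe_le_coe.1 ((h1.trans (mul_le_mul_right h2 _)).trans_eq (mul_one _))
      simp only at hc2
      rw [hc2] at h4
      rwa [one_div, NNReal.rpow_inv_le_iff hp'0] at h4
  obtain ⟨ι, s, e, η, hsvd, hs⟩ := exists_isSVD_of_sum_rpow_le hp'0 hmain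
  rw [schattenNorm, if_neg hp']
  refine sInf_le_of_le ⟨ι, s, e, η, hsvd, rfl⟩ ?_
  refine (ENNReal.rpow_le_rpow hs (by positivity)).trans (le_of_eq ?_)
  rw [← ENNReal.coe_rpow_of_nonneg _ (by positivity), ← NNReal.rpow_mul,
    mul_one_div_cancel hp'0.ne', NNReal.rpow_one]

/-- The trace dual of a bounded linear map between Schatten classes, on a single operator. -/
theorem exists_traceDual [CompleteSpace H] {p p' q q' : ℝ≥0∞}
    (hp : ENNReal.HolderConjugate p p') (hq : ENNReal.HolderConjugate q q')
    {Φ : (H →L[ℂ] H) → (H →L[ℂ] H)} {C : ℝ≥0}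
    (hadd : ∀ S ∈ schattenClass H p, ∀ T ∈ schattenClass H p, Φ (S + T) = Φ S + Φ T)
    (hsmul : ∀ (c : ℂ), ∀ T ∈ schattenClass H p, Φ (c • T) = c • Φ T)
    (hbound : ∀ T ∈ schattenClass H p, schattenNorm q (Φ T) ≤ C * schattenNorm p T)
    {T : H →L[ℂ] H} (hT : T ∈ schattenClass H q') :
    ∃ X : H →L[ℂ] H, (∀ f g, inner ℂ g (X f) = trace (T ∘L Φ (rankOne ℂ f g))) ∧
      schattenNorm p' X ≤ C * schattenNorm q' T := by
  have hΦ : ∀ S ∈ schattenClass H p, Φ S ∈ schattenClass H q := fun S hS =>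
    (hbound S hS).trans_lt (ENNReal.mul_lt_top ENNReal.coe_lt_top hS)
  have hT' : schattenNorm q' T ≠ ∞ := ne_of_lt hT
  have hold := fun S hS => trace_comp_holder hq.symm hT (hΦ S hS)
  obtain ⟨X, hX, hX'⟩ := exists_representing_operator hp (L := fun S => trace (T ∘L Φ S))
    (K := C * (schattenNorm q' T).toNNReal)
    (fun S hS R hR => by
      rw [hadd S hS R hR, ContinuousLinearMap.comp_add, trace_add (hold S hS).1 (hold R hR).1])
    (fun c S hS => by rw [hsmul c S hS, ContinuousLinearMap.comp_smul, trace_smul])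
    (fun S hS => by
      refine (hold S hS).2.trans ?_
      rw [ENNReal.coe_mul, ENNReal.coe_toNNReal hT', mul_comm (C : ℝ≥0∞), mul_assoc]
      gcongr
      exact hbound S hS)
  refine ⟨X, hX, hX'.trans (le_of_eq ?_)⟩
  rw [ENNReal.coe_mul, ENNReal.coe_toNNReal hT']

end Duality

/-! ### Exchanging weak integrals with traces. -/

section WeakIntegral

variable {H : Type} [NormedAddCommGroup H] [InnerProductSpace ℂ H]
  {Z : Type} [MeasurableSpace Z] {μ : Measure Z}

/-- A family of functionals that is pointwise integrable defines a bounded operator into `L¹`. -/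
theorem exists_clm_toL1 [CompleteSpace H] {φ : Z → H →L[ℂ] ℂ}
    (h : ∀ x, Integrable (fun z => φ z x) μ) :
    ∃ L : H →L[ℂ] Lp ℂ 1 μ, ∀ x, L x = (h x).toL1 _ := by
  let g : H →ₗ[ℂ] Lp ℂ 1 μ :=
    { toFun := fun x => (h x).toL1 _
      map_add' := fun x y => by
        rw [← Integrable.toL1_add]
        exact (Integrable.toL1_eq_toL1_iff _ _ _ _).2 (.of_forall fun z => by simp)
      map_smul' := fun c x => by
        rw [RingHom.id_apply, ← Integrable.toL1_smul]
        exact (Integrable.toL1_eq_toL1_iff _ _ _ _).2 (.of_forall fun z => by simp) }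
  -- Closed graph theorem: an `L¹` limit is an almost everywhere limit along a subsequence, while
  -- each `φ z` is continuous.
  refine ⟨⟨g, LinearMap.continuous_of_seq_closed_graph g fun u x y hu hy => ?_⟩, fun x => rfl⟩
  obtain ⟨ns, hns, hae⟩ := (tendstoInMeasure_of_tendsto_Lp hy).exists_seq_tendsto_ae
  refine Lp.ext ?_
  have h1 : ∀ᵐ z ∂μ, ∀ n, (g (u (ns n)) : Z → ℂ) z = φ z (u (ns n)) :=
    ae_all_iff.2 fun n => (h (u (ns n))).coeFn_toL1
  have h2 : (g x : Z → ℂ) =ᵐ[μ] fun z => φ z x := (h x).coeFn_toL1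
  filter_upwards [hae, h1, h2] with z hz hz1 hz2
  rw [hz2]
  refine tendsto_nhds_unique hz ?_
  simp only [Function.comp_apply, hz1]
  exact ((φ z).continuous.tendsto x).comp (hu.comp hns.tendsto_atTop)

/-- The matrix coefficients of a weakly integrable operator-valued function are uniformly bounded
in `L¹`. -/
theorem exists_integral_norm_inner_le [CompleteSpace H] {F : Z → H →L[ℂ] H}
    (hF : ∀ f g : H, Integrable (fun z => inner ℂ g (F z f)) μ) :
    ∃ C : ℝ, ∀ f g : H, ∫ z, ‖inner ℂ g (F z f)‖ ∂μ ≤ C * ‖f‖ * ‖g‖ := by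
  have hF' : ∀ f g : H, Integrable (fun z => innerSL ℂ (F z f) g) μ := fun f g => by
    refine (Complex.conjCLE.toContinuousLinearMap.integrable_comp (hF f g)).congr
      (.of_forall fun z => ?_)
    simp
  have hF'' : ∀ g f : H, Integrable (fun z => (innerSL ℂ g ∘L F z) f) μ := fun g f => hF f g
  choose L hL using fun f : H => exists_clm_toL1 (φ := fun z => innerSL ℂ (F z f)) (hF' f)
  choose R hR using fun g : H => exists_clm_toL1 (φ := fun z => innerSL ℂ g ∘L F z)
    (hF'' g)
  have hLn : ∀ f g, ‖L f g‖ = ∫ z, ‖inner ℂ g (F z f)‖ ∂μ := fun f g => by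
    rw [hL, L1.norm_of_fun_eq_integral_norm]
    simp [norm_inner_symm]
  have hRn : ∀ f g, ‖R g f‖ = ∫ z, ‖inner ℂ g (F z f)‖ ∂μ := fun f g => by
    rw [hR, L1.norm_of_fun_eq_integral_norm]
    simp
  -- Continuity in each variable separately gives a joint bound, by uniform boundedness over the
  -- unit ball in `f`.
  obtain ⟨C, hC⟩ := banach_steinhaus (g := fun f : Metric.closedBall (0 : H) 1 => L f) fun g =>
    ⟨‖R g‖, fun f => by
      rw [hLn, ← hRn]
      refine (R g).le_of_opNorm_le_of_le le_rfl (mem_closedBall_zero_iff.1 f.2) |>.trans ?_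
      simp⟩
  refine ⟨C, fun f g => ?_⟩
  have hhom : ∀ (c : ℂ), ∫ z, ‖inner ℂ g (F z (c • f))‖ ∂μ =
      ‖c‖ * ∫ z, ‖inner ℂ g (F z f)‖ ∂μ := fun c => by
    simp only [map_smul, inner_smul_right, norm_mul]
    exact integral_const_mul _ _
  rcases eq_or_ne f 0 with rfl | hf
  · simp
  have hf' : 0 < ‖f‖ := norm_pos_iff.2 hf
  have h1 := (L (((‖f‖ : ℂ)⁻¹) • f)).le_of_opNorm_le
    (hC ⟨((‖f‖ : ℂ)⁻¹) • f, by simp [norm_smul, hf]⟩) g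
  rw [hLn, hhom] at h1
  simp only [norm_inv, Complex.norm_real, norm_norm] at h1
  rw [inv_mul_le_iff₀ hf'] at h1
  linarith

/-- A summable `s` has countable support, and exchanging sum and integral needs a countable index.
-/
theorem IsSVD.restrict_support {ι : Type} {T : H →L[ℂ] H} {s : ι → ℝ≥0} {e η : ι → H}
    (h : IsSVD T s e η) :
    IsSVD T (fun i : Function.support s => s i) (fun i => e i) (fun i => η i) := by
  refine ⟨h.1.comp _ Subtype.val_injective, h.2.1.comp _ Subtype.val_injective, ?_⟩
  have hsub : Function.support (fun i => ((s i : ℝ) : ℂ) • rankOne ℂ (e i) (η i)) ⊆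
      Function.support s := fun i hi hs => hi (by
    change ((s i : ℝ) : ℂ) • rankOne ℂ (e i) (η i) = 0
    rw [hs, NNReal.coe_zero, Complex.ofReal_zero, zero_smul])
  exact (hasSum_subtype_iff_of_support_subset hsub).2 h.2.2

theorem exists_isSVD_of_mem_schattenClass_one {T : H →L[ℂ] H} (hT : T ∈ schattenClass H 1) :
    ∃ (ι : Type) (s : ι → ℝ≥0) (e η : ι → H), IsSVD T s e η ∧
      ∑' i, (s i : ℝ≥0∞) ≠ ∞ := by
  have hT' : schattenNorm 1 T < ∞ := hT
  rw [schattenNorm, if_neg ENNReal.one_ne_top] at hT'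
  obtain ⟨c, ⟨ι, s, e, η, h, hc⟩, hlt⟩ := sInf_lt_iff.1 hT'
  rw [hc, ENNReal.toReal_one, one_div_one, ENNReal.rpow_one] at hlt
  refine ⟨ι, s, e, η, h, ?_⟩
  simpa only [ENNReal.rpow_one] using hlt.ne

/-- An operator of trace class has a singular value decomposition indexed by a countable type. -/
theorem exists_countable_isSVD {T : H →L[ℂ] H} (hT : T ∈ schattenClass H 1) :
    ∃ (ι : Type) (s : ι → ℝ≥0) (e η : ι → H), Countable ι ∧ IsSVD T s e η ∧
      ∑' i, (s i : ℝ≥0∞) ≠ ∞ := by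
  obtain ⟨ι, s, e, η, h, hs⟩ := exists_isSVD_of_mem_schattenClass_one hT
  have hsum : Summable s := ENNReal.tsum_coe_ne_top_iff_summable.1 hs
  have hc : Countable (Function.support s) := hsum.countable_support_nnreal.to_subtype
  have hs' : ∑' i : Function.support s, (s i : ℝ≥0∞) ≠ ∞ :=
    ENNReal.tsum_coe_ne_top_iff_summable.2
      (NNReal.summable_comp_injective hsum Subtype.val_injective)
  exact ⟨Function.support s, fun i => s i, fun i => e i, fun i => η i, hc,
    h.restrict_support, hs'⟩

/-- Weak integrals commute with the trace against an operator of trace class. -/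
theorem IsWeakIntegral.integral_trace [CompleteSpace H] {F : Z → H →L[ℂ] H} {A : H →L[ℂ] H}
    (hA : IsWeakIntegral μ F A) {T : H →L[ℂ] H} (hT : T ∈ schattenClass H 1) :
    ∫ z, trace (T ∘L F z) ∂μ = trace (T ∘L A) := by
  obtain ⟨ι, s, e, η, hι, hsvd, hs⟩ := exists_countable_isSVD hT
  obtain ⟨C, hC⟩ := exists_integral_norm_inner_le fun f g => (hA f g).1
  simp only [(hsvd.trace_comp_left hs _).1, ← (hA _ _).2]
  have hsum : Summable fun i => (s i : ℝ) * C :=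
    (NNReal.summable_coe.2 (ENNReal.tsum_coe_ne_top_iff_summable.1 hs)).mul_right C
  -- The `i`-th term has `L¹` norm at most `sᵢ C`, with `C` uniform over unit vectors.
  rw [← integral_tsum_of_summable_integral_norm (fun i => ((hA (e i) (η i)).1.const_mul _))
    (Summable.of_nonneg_of_le (fun i => by positivity) (fun i => ?_) hsum)]
  · simp only [integral_const_mul]
  · simp only [norm_mul, integral_const_mul]
    have := hC (e i) (η i)
    rw [hsvd.1.1, hsvd.2.1.1] at this
    simp only [Complex.norm_real, NNReal.norm_eq]
    gcongr
    simpa using this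

end WeakIntegral

/-! ### Conjugation by an isometric involution, and inclusions of Schatten classes. -/

section Conjugation

variable {H : Type} [NormedAddCommGroup H] [InnerProductSpace ℂ H]

theorem inner_involution_left {U : H →ₗᵢ[ℂ] H} (hU : ∀ x, U (U x) = x) (x y : H) :
    inner ℂ (U x) y = inner ℂ x (U y) := by
  rw [← U.inner_map_map x (U y), hU]

theorem conj_rankOne {U : H →ₗᵢ[ℂ] H} (hU : ∀ x, U (U x) = x) (f g : H) :
    U.toContinuousLinearMap ∘L rankOne ℂ f g ∘L U.toContinuousLinearMap =
      rankOne ℂ (U f) (U g) := by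
  ext x
  simp [inner_involution_left hU]

theorem IsSVD.conj {U : H →ₗᵢ[ℂ] H} (hU : ∀ x, U (U x) = x) {ι : Type} {T : H →L[ℂ] H}
    {s : ι → ℝ≥0} {e η : ι → H} (h : IsSVD T s e η) :
    IsSVD (U.toContinuousLinearMap ∘L T ∘L U.toContinuousLinearMap) s (fun i => U (e i))
      (fun i => U (η i)) := by
  refine ⟨h.1.comp_linearIsometry U, h.2.1.comp_linearIsometry U, ?_⟩
  have h1 := (h.2.2.mapL ((ContinuousLinearMap.compL ℂ H H H).flip
    U.toContinuousLinearMap)).mapL (ContinuousLinearMap.compL ℂ H H H U.toContinuousLinearMap)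
  refine h1.congr_fun fun i => ?_
  rw [← conj_rankOne hU]
  simp

theorem schattenNorm_conj_le {U : H →ₗᵢ[ℂ] H} (hU : ∀ x, U (U x) = x) (p : ℝ≥0∞)
    (T : H →L[ℂ] H) :
    schattenNorm p (U.toContinuousLinearMap ∘L T ∘L U.toContinuousLinearMap) ≤
      schattenNorm p T := by
  by_cases hp : p = ∞
  · simp only [schattenNorm, if_pos hp, ← ofReal_norm]
    refine ENNReal.ofReal_le_ofReal (ContinuousLinearMap.opNorm_le_bound _ (norm_nonneg _)
      fun x => ?_)
    simpa using T.le_opNorm (U x)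
  · simp only [schattenNorm, if_neg hp]
    refine sInf_le_sInf ?_
    rintro _ ⟨ι, s, e, η, h, rfl⟩
    exact ⟨ι, s, _, _, h.conj hU, rfl⟩

theorem conj_mem_schattenClass {U : H →ₗᵢ[ℂ] H} (hU : ∀ x, U (U x) = x) {p : ℝ≥0∞}
    {T : H →L[ℂ] H} (hT : T ∈ schattenClass H p) :
    U.toContinuousLinearMap ∘L T ∘L U.toContinuousLinearMap ∈ schattenClass H p :=
  (schattenNorm_conj_le hU p T).trans_lt hT

/-- By `IsSVD.trace_comp_left` both sides are the series `∑ sᵢ ⟨B U eᵢ, U ηᵢ⟩`. -/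
theorem trace_conj_comp [CompleteSpace H] {U : H →ₗᵢ[ℂ] H} (hU : ∀ x, U (U x) = x)
    {T : H →L[ℂ] H} (hT : T ∈ schattenClass H 1) (B : H →L[ℂ] H) :
    trace ((U.toContinuousLinearMap ∘L T ∘L U.toContinuousLinearMap) ∘L B) =
      trace (T ∘L (U.toContinuousLinearMap ∘L B ∘L U.toContinuousLinearMap)) := by
  obtain ⟨ι, s, e, η, -, hsvd, hs⟩ := exists_countable_isSVD hT
  rw [((hsvd.conj hU).trace_comp_left hs B).1, (hsvd.trace_comp_left hs _).1]
  simp [inner_involution_left hU]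

theorem trace_rankOne_comp [CompleteSpace H] (f g : H) (B : H →L[ℂ] H) :
    trace (rankOne ℂ f g ∘L B) = inner ℂ g (B f) := by
  have := (traceBasis H).tsum_inner_mul_inner (ContinuousLinearMap.adjoint B g) f
  rw [ContinuousLinearMap.adjoint_inner_left] at this
  rw [← this, trace_eq]
  simp [ContinuousLinearMap.adjoint_inner_left]

theorem schattenClass_one_subset {p : ℝ≥0∞} (hp : 1 ≤ p) :
    schattenClass H 1 ⊆ schattenClass H p := by
  intro T hT
  by_cases htop : p = ∞
  · simp [schattenClass, schattenNorm, htop]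
  obtain ⟨ι, s, e, η, -, h, hs⟩ := exists_countable_isSVD hT
  have hp1 : 1 ≤ p.toReal := by
    simpa using ENNReal.toReal_mono htop hp
  change schattenNorm p T < ∞
  rw [schattenNorm, if_neg htop]
  refine sInf_lt_iff.2 ⟨_, ⟨ι, s, e, η, h, rfl⟩, ?_⟩
  refine (ENNReal.rpow_lt_top_of_nonneg (by positivity) ?_)
  -- Each singular value is at most the sum of all, so `sᵢ^p ≤ sᵢ (∑ s)^{p-1}`.
  refine ne_top_of_le_ne_top (b := (∑' i, (s i : ℝ≥0∞)) *
    (∑' i, (s i : ℝ≥0∞)) ^ (p.toReal - 1)) (ENNReal.mul_ne_top hs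
      (ENNReal.rpow_ne_top_of_nonneg (by linarith) hs)) ?_
  rw [← ENNReal.tsum_mul_right]
  refine ENNReal.tsum_le_tsum fun i => ?_
  nth_rewrite 1 [show p.toReal = 1 + (p.toReal - 1) by ring]
  rw [ENNReal.rpow_add_of_nonneg _ _ zero_le_one (by linarith), ENNReal.rpow_one]
  gcongr
  exact ENNReal.le_tsum i

end Conjugation

/-! ### Parity, time-frequency shifts and the dual extension. -/

section Multiplier

variable {d : ℕ}

/-- The parity operator `f ↦ f(-·)` on `L²(ℝ^d)`. -/
def parity (d : ℕ) : L2 d →ₗᵢ[ℂ] L2 d :=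
  Lp.compMeasurePreservingₗᵢ ℂ (fun t => -t) (Measure.measurePreserving_neg volume)

theorem coeFn_parity (f : L2 d) : (parity d f : Config d → ℂ) =ᵐ[volume] fun t => f (-t) :=
  Lp.coeFn_compMeasurePreserving f (Measure.measurePreserving_neg volume)

theorem parity_parity (f : L2 d) : parity d (parity d f) = f := by
  refine Lp.ext ?_
  have h := (Measure.measurePreserving_neg (volume : Measure (Config d))).quasiMeasurePreserving.ae
    (coeFn_parity f)
  filter_upwards [coeFn_parity (parity d f), h] with t h1 h2
  rw [h1, h2, neg_neg]

/-- The symmetric normalisation enters here: the two factors `e^{-πi x·ξ}` cancel the `e^{2πi x·ξ}`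
produced by the translation, with no phase left over. -/
theorem parity_rho_parity_rho (z : Phase d) (f : L2 d) :
    parity d (rho z (parity d (rho z f))) = f := by
  refine Lp.ext ?_
  have hneg := (Measure.measurePreserving_neg
    (volume : Measure (Config d))).quasiMeasurePreserving
  have hsub := (measurePreserving_sub_right
    (volume : Measure (Config d)) z.1).quasiMeasurePreserving
  filter_upwards [coeFn_parity (rho z (parity d (rho z f))),
    hneg.ae (coeFn_rho z (parity d (rho z f))),
    hneg.ae (hsub.ae (coeFn_parity (rho z f))),
    hneg.ae (hsub.ae (hneg.ae (coeFn_rho z f)))] with t h1 h2 h3 h4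
  rw [h1, h2, shiftFun, h3, h4, shiftFun]
  have h5 : -(-t - z.1) - z.1 = t := by abel
  rw [h5, ← mul_assoc, ← Complex.exp_add, ← mul_assoc, ← Complex.exp_add, ← Complex.exp_add]
  have h6 : inner ℝ z.2 (-(-t - z.1)) = inner ℝ z.2 t + inner ℝ z.1 z.2 := by
    rw [neg_sub, sub_neg_eq_add, inner_add_right, real_inner_comm z.1 z.2, add_comm]
  rw [h6, inner_neg_right]
  convert one_mul _
  rw [Complex.exp_eq_one_iff]
  refine ⟨0, ?_⟩
  push_cast
  ring

theorem adjoint_rho (z : Phase d) :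
    ContinuousLinearMap.adjoint (rho z) =
      (parity d).toContinuousLinearMap ∘L rho z ∘L (parity d).toContinuousLinearMap := by
  symm
  rw [ContinuousLinearMap.eq_adjoint_iff]
  intro x y
  have h := (rhoIsometry z).inner_map_map (parity d (rho z (parity d x))) y
  have h2 : rho z (parity d (rho z (parity d x))) = parity d (parity d x) := by
    rw [← parity_rho_parity_rho z (parity d x), parity_parity, parity_rho_parity_rho]
  change inner ℂ (rho z _) (rho z y) = _ at h
  rw [h2, parity_parity] at h
  exact h.symm

/-- The matrix coefficients of `ρ(z)` that define the weak integral are thus themselves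
Fourier–Wigner transforms, which makes the two arguments of the pairing interchangeable. -/
theorem fourierWigner_rankOne_parity (f g : L2 d) (z : Phase d) :
    fourierWigner (rankOne ℂ (parity d f) (parity d g)) z = inner ℂ g (rho z f) := by
  rw [fourierWigner, trace_rankOne_comp, adjoint_rho]
  simp [inner_involution_left parity_parity, parity_parity]

/-- The dual of a bounded extension of a multiplier, conjugated with the parity operator, is a
bounded extension of the same multiplier for the conjugate exponents. -/
theorem IsBoundedExtension.exists_dual {p p' q q' : ℝ≥0∞} (hp : ENNReal.HolderConjugate p p')
    (hq : ENNReal.HolderConjugate q q') {m : LInfty d} {C : ℝ≥0}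
    {Φ : (L2 d →L[ℂ] L2 d) → (L2 d →L[ℂ] L2 d)} (hΦ : IsBoundedExtension m p q C Φ) :
    ∃ Ψ, IsBoundedExtension m q' p' C Ψ := by
  -- A choice of `X` for all `T`, with value `0` where nothing represents the functional. Stating it
  -- as uniqueness yields linearity in `T` on `S^{q'}`.
  have hdual : ∀ T : L2 d →L[ℂ] L2 d, ∃ X : L2 d →L[ℂ] L2 d, ∀ Y : L2 d →L[ℂ] L2 d,
      (∀ f g, inner ℂ g (Y f) = trace (T ∘L Φ (rankOne ℂ f g))) → X = Y := fun T => by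
    by_cases hT : ∃ Y : L2 d →L[ℂ] L2 d, ∀ f g, inner ℂ g (Y f) = trace (T ∘L Φ (rankOne ℂ f g))
    · obtain ⟨X, hX⟩ := hT
      exact ⟨X, fun Y hY => ContinuousLinearMap.ext fun f =>
        ext_inner_left ℂ fun g => by rw [hX, hY]⟩
    · exact ⟨0, fun Y hY => (hT ⟨Y, hY⟩).elim⟩
  choose X hX using hdual
  have hXd : ∀ T ∈ schattenClass (L2 d) q',
      (∀ f g, inner ℂ g (X T f) = trace (T ∘L Φ (rankOne ℂ f g))) ∧
        schattenNorm p' (X T) ≤ C * schattenNorm q' T := fun T hT => by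
    obtain ⟨Y, hY⟩ := exists_traceDual hp hq hΦ.map_add hΦ.map_smul hΦ.bound hT
    rwa [hX T Y hY.1]
  have hp1 := ENNReal.HolderConjugate.one_le p p'
  have hsd : ∀ T ∈ schattenClass (L2 d) q', ∀ f g : L2 d,
      HasSummableDiagonal (T ∘L Φ (rankOne ℂ f g)) := fun T hT f g =>
    (trace_comp_holder hq.symm hT ((hΦ.bound _ (rankOne_mem_schattenClass hp1 f g)).trans_lt
        (ENNReal.mul_lt_top ENNReal.coe_lt_top (rankOne_mem_schattenClass hp1 f g)))).1
  set U := (parity d).toContinuousLinearMap with hU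
  have hUU := parity_parity (d := d)
  -- The integrability half of the weak integral depends on `m` and `T` but not on the extension, so
  -- it is inherited from `Φ`.
  refine ⟨fun T => U ∘L X (U ∘L T ∘L U) ∘L U, ⟨fun S hS T hT => ?_, fun c T hT => ?_,
    fun T hT => ?_, fun T hT f g => ⟨(hΦ.extends_multiplier T hT f g).1, ?_⟩⟩⟩
  · have hS' := conj_mem_schattenClass hUU hS
    have hT' := conj_mem_schattenClass hUU hT
    rw [← ContinuousLinearMap.comp_add, ← ContinuousLinearMap.add_comp]
    congr 2
    refine hX _ _ fun f g => ?_
    rw [add_apply, inner_add_right, (hXd _ hS').1, (hXd _ hT').1,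
      ← trace_add (hsd _ hS' f g) (hsd _ hT' f g), ContinuousLinearMap.add_comp,
      ContinuousLinearMap.comp_add, ContinuousLinearMap.add_comp]
  · have hT' := conj_mem_schattenClass hUU hT
    rw [← ContinuousLinearMap.comp_smul, ← ContinuousLinearMap.smul_comp]
    congr 2
    refine hX _ _ fun f g => ?_
    rw [smul_apply, inner_smul_right, (hXd _ hT').1, ← trace_smul, ContinuousLinearMap.smul_comp,
      ContinuousLinearMap.comp_smul, ContinuousLinearMap.smul_comp]
  · refine (schattenNorm_conj_le hUU _ _).trans
      ((hXd _ (conj_mem_schattenClass hUU hT)).2.trans ?_)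
    gcongr
    exact schattenNorm_conj_le hUU _ _
  · have hT' := schattenClass_one_subset (ENNReal.HolderConjugate.one_le q' q) hT
    have h1 := (hΦ.extends_multiplier _ (rankOne_mem_schattenClass le_rfl (parity d f)
      (parity d g))).integral_trace (conj_mem_schattenClass hUU hT)
    have h2 : inner ℂ g ((U ∘L X (U ∘L T ∘L U) ∘L U) f) =
        trace ((U ∘L T ∘L U) ∘L Φ (rankOne ℂ (parity d f) (parity d g))) := by
      rw [← (hXd _ (conj_mem_schattenClass hUU hT')).1]
      exact (inner_involution_left hUU _ _).symm
    rw [h2, ← h1]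
    -- Both integrands equal `m(z) F_W(T)(z) ⟨ρ(z)f, g⟩`.
    refine integral_congr_ae (.of_forall fun z => ?_)
    simp only [ContinuousLinearMap.comp_smul, trace_smul, smul_apply, inner_smul_right]
    rw [fourierWigner_rankOne_parity, trace_conj_comp hUU hT, ← adjoint_rho, fourierWigner]
    ring

theorem multipliers_subset {p p' q q' : ℝ≥0∞} (hp : ENNReal.HolderConjugate p p')
    (hq : ENNReal.HolderConjugate q q') : multipliers d p q ⊆ multipliers d q' p' :=
  fun _ ⟨C, _, hΦ⟩ => ⟨C, hΦ.exists_dual hp hq⟩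

theorem multiplierNorm_le {p p' q q' : ℝ≥0∞} (hp : ENNReal.HolderConjugate p p')
    (hq : ENNReal.HolderConjugate q q') (m : LInfty d) :
    multiplierNorm q' p' m ≤ multiplierNorm p q m := by
  refine sInf_le_sInf ?_
  rintro _ ⟨C, Φ, hΦ, rfl⟩
  obtain ⟨Ψ, hΨ⟩ := hΦ.exists_dual hp hq
  exact ⟨C, Ψ, hΨ, rfl⟩

end Multiplier

end QHA

end

theorem mainTheorem5 (d : ℕ) (p p' q q' : ℝ≥0∞)
    (hp : ENNReal.HolderConjugate p p') (hq : ENNReal.HolderConjugate q q') :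
    QHA.multipliers d p q = QHA.multipliers d q' p' ∧
      ∀ m ∈ QHA.multipliers d p q,
        QHA.multiplierNorm p q m = QHA.multiplierNorm q' p' m :=
  ⟨(QHA.multipliers_subset hp hq).antisymm (QHA.multipliers_subset hq.symm hp.symm), fun m _ =>
    (QHA.multiplierNorm_le hq.symm hp.symm m).antisymm (QHA.multiplierNorm_le hp hq m)⟩
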